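/- Fix $n\ge 1$, an integer $k\ge 1$ and a constant $A\ge 1$. Let $Q_0\subset\mathbb R^n$ be a cube with sides parallel to the axes, $\mathcal D(Q_0)$ the collection of its dyadic subcubes (including $Q_0$; cubes are taken half-open, which changes nothing up to null sets), and let $\lambda\in[0,n)$ and $p,q\in[1,\infty)$. Functions are real-valued and $|Q|$ denotes Lebesgue measure. **Definitions.** For $\mathcal S\subset\mathcal D(Q_0)$ and a cube $Q$, let $\mathrm{Ch}_{\mathcal S}(Q)$ be the set of maximal cubes (with respect to inclusion) of $\mathcal S$ strictly contained in $Q$. The family $\mathcal S$ is *sparse* if $\sum_{Q'\in\mathrm{Ch}_{\mathcal S}(Q)}|Q'|\le\frac12|Q|$ for every $Q\in\mathcal S$. Let $\mathcal P^n_{k-1}$ be the set of real polynomials on $\mathbb R^n$ of degree at most $k-1$, and for $f\in L^q(Q_0)$ put $$E_k(f;Q)_q=\inf_{m\in\mathcal P^n_{k-1}}\|f-m\|_{L^q(Q)},\qquad \|f\|_{SV}=\sup_{\mathcal S\ \mathrm{sparse}}\Big\|\sum_{Q\in\mathcal S}|Q|^{\frac{\lambda}{nq}-\frac1q}E_k(f;Q)_q\,\mathbf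 1_{Q\setminus\bigcup_{Q'\in\mathrm{Ch}_{\mathcal S}(Q)}Q'}\Big\|_{L^p(Q_0)}.$$ The sparse Brudnyi space $SV^{k,\lambda}_{p,q}(Q_0)$ is the set of $f\in L^q(Q_0)$ with $\|f\|_{SV}<\infty$. The dyadic fractional maximal function is $$M_{q,\lambda,Q_0}f(x)=\sup_{Q\in\mathcal D(Q_0),\,Q\ni x}\Big(|Q|^{\frac\lambda n-1}\int_Q|f|^q\Big)^{1/q},\qquad M_{Q_0}=M_{1,0,Q_0},$$ and $M_{q,\lambda,Q_0}L^p(Q_0)$ is the set of $f\in L^q(Q_0)$ with $M_{q,\lambda,Q_0}f\in L^p(Q_0)$. As usual $\frac1p+\frac1{p'}=1$ (so $p'=\infty$ if $p=1$). **Theorem.** One has $$SV^{k,\lambda}_{p,q}(Q_0)=M_{q,\lambda,Q_0}L^p(Q_0).$$ More precisely, there is a constant $c<\infty$ depending only on $n$, $k$ and $A$ (and not on $Q_0,\lambda,p,q$ or $f$) such that, for every $f\in L^q(Q_0)$ and every nearly best approximation $P^k_{Q_0}f$ of $f$ in $L^q(Q_0)$ with constant $A$, that is, every $P^k_{Q_0}f\in\mathcal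 P^n_{k-1}$ with $\|f-P^k_{Q_0}f\|_{L^q(Q_0)}\le A\,E_k(f;Q_0)_q$, $$\|M_{q,\lambda,Q_0}(f-P^k_{Q_0}f)\|_{L^p(Q_0)}\le c\,\|M_{Q_0}\|_{L^{p'}(Q_0)\to L^{p'}(Q_0)}\,\|f\|_{SV}$$ and $$\|f\|_{SV}\le 2\,\|M_{q,\lambda,Q_0}(f-P^k_{Q_0}f)\|_{L^p(Q_0)}.$$ Both inequalities hold in $[0,\infty]$, so that one side is finite exactly when the other is. -/

import Mathlib

open MeasureTheory Set
open scoped ENNReal NNReal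

noncomputable section

namespace SparseBrudnyi

variable {n : ℕ}

/-- The cube in `ℝⁿ` with sides parallel to the axes, lower corner `a` and side length `ℓ`.
Cubes are taken half-open, so that the dyadic subcubes of one generation partition it. -/
def cube (a : Fin n → ℝ) (ℓ : ℝ) : Set (Fin n → ℝ) :=
  Set.univ.pi fun i => Set.Ico (a i) (a i + ℓ)

/-- `𝓓(Q₀)` for `Q₀ = cube a ℓ`: all the cubes obtained by dividing each side of `Q₀` into `2 ^ j`
equal intervals, for `j = 0, 1, 2, …` (`Q₀` itself is the case `j = 0`). -/
def dyadicCubes (a : Fin n → ℝ) (ℓ : ℝ) : Set (Set (Fin n → ℝ)) :=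
  {Q | ∃ (j : ℕ) (m : Fin n → ℕ), (∀ i, m i < 2 ^ j) ∧
    Q = cube (fun i => a i + (m i : ℝ) * (ℓ / 2 ^ j)) (ℓ / 2 ^ j)}

/-- `Ch_S(Q)`: the maximal cubes (for inclusion) among the members of `S` strictly contained
in `Q`. -/
def children (S : Set (Set (Fin n → ℝ))) (Q : Set (Fin n → ℝ)) : Set (Set (Fin n → ℝ)) :=
  {R | Maximal (fun Q' => Q' ∈ S ∧ Q' ⊂ Q) R}

/-- A sparse family of dyadic subcubes of `Q₀ = cube a ℓ`: the children of each member `Q` have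
total volume at most `|Q| / 2`. -/
def IsSparse (a : Fin n → ℝ) (ℓ : ℝ) (S : Set (Set (Fin n → ℝ))) : Prop :=
  S ⊆ dyadicCubes a ℓ ∧
    ∀ Q ∈ S, ∑' R : children S Q, volume (R : Set (Fin n → ℝ)) ≤ volume Q / 2

/-- The set `Q` minus the union of its children in `S`. -/
def remainder (S : Set (Set (Fin n → ℝ))) (Q : Set (Fin n → ℝ)) : Set (Fin n → ℝ) :=
  Q \ ⋃ R ∈ children S Q, R

/-- `E_k(f; Q)_q`, for `k ≥ 1`: the distance in `L^q(Q)` from `f` to the polynomials of total degree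
at most `k - 1`. -/
def bestApprox (k : ℕ) (q : ℝ≥0∞) (f : (Fin n → ℝ) → ℝ) (Q : Set (Fin n → ℝ)) : ℝ≥0∞ :=
  ⨅ m ∈ MvPolynomial.restrictTotalDegree (Fin n) ℝ (k - 1),
    eLpNorm (fun x => f x - MvPolynomial.eval x m) q (volume.restrict Q)

/-- The functional `‖f‖` of the sparse Brudnyi space `SV^{k,lam}_{p,q}(Q₀)`, `Q₀ = cube a ℓ`: the
supremum over the sparse families `S` of the `L^p(Q₀)` norm of
`∑_{Q ∈ S} |Q|^{lam/(nq) - 1/q} E_k(f; Q)_q 1_{Q \ ⋃ Ch_S(Q)}`. -/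
def svNorm (a : Fin n → ℝ) (ℓ : ℝ) (k : ℕ) (lam : ℝ) (p q : ℝ≥0∞) (f : (Fin n → ℝ) → ℝ) : ℝ≥0∞ :=
  ⨆ (S : Set (Set (Fin n → ℝ))) (_ : IsSparse a ℓ S),
    eLpNorm
      (fun x => ∑' Q : S, (remainder S (Q : Set (Fin n → ℝ))).indicator
        (fun _ => volume (Q : Set (Fin n → ℝ)) ^ (lam / (n * q.toReal) - 1 / q.toReal)
          * bestApprox k q f Q) x)
      p (volume.restrict (cube a ℓ))

/-- The sparse Brudnyi space `SV^{k,lam}_{p,q}(Q₀)`, `Q₀ = cube a ℓ`. -/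
def svSpace (a : Fin n → ℝ) (ℓ : ℝ) (k : ℕ) (lam : ℝ) (p q : ℝ≥0∞) : Set ((Fin n → ℝ) → ℝ) :=
  {f | MemLp f q (volume.restrict (cube a ℓ)) ∧ svNorm a ℓ k lam p q f < ∞}

/-- The dyadic local fractional maximal function `M_{q,lam,Q₀} f`, `Q₀ = cube a ℓ`. -/
def fracMaximal (a : Fin n → ℝ) (ℓ : ℝ) (q : ℝ≥0∞) (lam : ℝ) (f : (Fin n → ℝ) → ℝ)
    (x : Fin n → ℝ) : ℝ≥0∞ :=
  ⨆ (Q : Set (Fin n → ℝ)) (_ : Q ∈ dyadicCubes a ℓ) (_ : x ∈ Q),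
    (volume Q ^ (lam / n - 1) * ∫⁻ y in Q, ‖f y‖ₑ ^ q.toReal) ^ (1 / q.toReal)

/-- The space `M_{q,lam,Q₀} L^p(Q₀)`, `Q₀ = cube a ℓ`: the functions of `L^q(Q₀)` whose fractional
maximal function lies in `L^p(Q₀)`. -/
def fracMaximalLp (a : Fin n → ℝ) (ℓ : ℝ) (q : ℝ≥0∞) (lam : ℝ) (p : ℝ≥0∞) :
    Set ((Fin n → ℝ) → ℝ) :=
  {f | MemLp f q (volume.restrict (cube a ℓ)) ∧
    eLpNorm (fracMaximal a ℓ q lam f) p (volume.restrict (cube a ℓ)) < ∞}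

/-- The dyadic maximal function `M_{Q₀} f`, `Q₀ = cube a ℓ`. -/
def dyadicMaximal (a : Fin n → ℝ) (ℓ : ℝ) (f : (Fin n → ℝ) → ℝ) (x : Fin n → ℝ) : ℝ≥0∞ :=
  ⨆ (Q : Set (Fin n → ℝ)) (_ : Q ∈ dyadicCubes a ℓ) (_ : x ∈ Q),
    (volume Q)⁻¹ * ∫⁻ y in Q, ‖f y‖ₑ

/-- The operator norm of `M_{Q₀} : L^r(Q₀) → L^r(Q₀)`, `Q₀ = cube a ℓ`: the least `C` such that
`‖M_{Q₀} g‖_{L^r(Q₀)} ≤ C ‖g‖_{L^r(Q₀)}` for all `g` in `L^r(Q₀)`. -/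
def dyadicMaximalOpNorm (a : Fin n → ℝ) (ℓ : ℝ) (r : ℝ≥0∞) : ℝ≥0∞ :=
  sInf {C : ℝ≥0∞ | ∀ g : (Fin n → ℝ) → ℝ, MemLp g r (volume.restrict (cube a ℓ)) →
    eLpNorm (dyadicMaximal a ℓ g) r (volume.restrict (cube a ℓ))
      ≤ C * eLpNorm g r (volume.restrict (cube a ℓ))}

/-- The polynomial `P` of degree at most `k - 1` is a nearly best approximation, with constant `A`,
of `f` in `L^q(Q)`. -/
def IsNearlyBest (A : ℝ≥0) (k : ℕ) (q : ℝ≥0∞) (f : (Fin n → ℝ) → ℝ) (Q : Set (Fin n → ℝ))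
    (P : MvPolynomial (Fin n) ℝ) : Prop :=
  P ∈ MvPolynomial.restrictTotalDegree (Fin n) ℝ (k - 1) ∧
    eLpNorm (fun x => f x - MvPolynomial.eval x P) q (volume.restrict Q) ≤ A * bestApprox k q f Q

end SparseBrudnyi

end

noncomputable section

/-! ### Geometry of the dyadic cubes -/

namespace SparseBrudnyi

variable {n : ℕ}

/-! The remainders of a sparse family are pairwise disjoint, so at each point the sparse sum has at
most one nonzero term. That term is at most the fractional maximal function of f - P, because E_k is
an infimum over polynomials. This is the second inequality, with constant 1
(`svNorm_le_eLpNorm_fracMaximal`).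

For the first inequality, a stopping family is grown from Q₀: below a cube Q with nearly best
polynomial P_Q, the maximal dyadic cubes on which the L^q average of f - P_Q more than doubles are
selected. They fill at most half of Q, so the family is sparse (`tsum_volume_le_half`). On a
selected cube Q', P_Q is exchanged for P_{Q'}. The error is a polynomial of bounded degree, so its
average on any dyadic R ⊆ Q' is controlled by its average on Q' (`exists_avgNorm_eval_le`,
equivalence of norms in finite dimension plus scaling). The latter is controlled by the average of f
- P_Q on Q, since the dyadic parent of Q' was not selected (`avgNorm_le_of_maximal`). Iterating down
to R, and using lam ≥ 0 to replace powers of |R| by powers of larger cubes, bounds the fractional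
maximal function pointwise by the sum of |Q|^{lam/(nq) - 1/q} E_k(f; Q)_q over the family, with full
indicators of the cubes (`exists_isSparse_fracMaximal_le`).

Full indicators become remainders by duality (`eLpNorm_tsum_indicator_le`): a remainder has at least
half the volume of its cube, so ∫_Q h is at most twice the integral of M_{Q₀} h over the remainder.
Hölder then costs the norm of M_{Q₀} on L^{p'}.

The equality of the spaces needs in addition that this norm is finite, as p' > 1
(`dyadicMaximalOpNorm_ne_top`), and that replacing f - P by f raises the fractional maximal function
by at most a finite constant (`exists_fracMaximal_le_add`). -/

theorem measurableSet_cube (a : Fin n → ℝ) (ℓ : ℝ) : MeasurableSet (cube a ℓ) :=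
  MeasurableSet.univ_pi fun _ => measurableSet_Ico

theorem volume_cube (a : Fin n → ℝ) (ℓ : ℝ) : volume (cube a ℓ) = ENNReal.ofReal ℓ ^ n := by
  simp [cube, Real.volume_pi_Ico]

theorem mem_cube {a x : Fin n → ℝ} {ℓ : ℝ} : x ∈ cube a ℓ ↔ ∀ i, a i ≤ x i ∧ x i < a i + ℓ := by
  simp [cube]

theorem volume_cube_pos (a : Fin n → ℝ) {ℓ : ℝ} (hℓ : 0 < ℓ) : volume (cube a ℓ) ≠ 0 := by
  rw [volume_cube]
  exact pow_ne_zero _ (by simpa using hℓ)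

theorem volume_cube_ne_top (a : Fin n → ℝ) (ℓ : ℝ) : volume (cube a ℓ) ≠ ∞ := by
  rw [volume_cube]
  exact ENNReal.pow_ne_top ENNReal.ofReal_ne_top

theorem corner_mem_cube (a : Fin n → ℝ) {ℓ : ℝ} (hℓ : 0 < ℓ) : a ∈ cube a ℓ :=
  mem_cube.2 fun _ => ⟨le_rfl, by linarith⟩

/-- The index, along each axis, of the interval of length `ℓ / 2 ^ j` of the dyadic grid that
contains `x`. -/
def gridIndex (a : Fin n → ℝ) (ℓ : ℝ) (j : ℕ) (x : Fin n → ℝ) (i : Fin n) : ℤ :=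
  ⌊(x i - a i) / ℓ * (2 ^ j : ℕ)⌋

/-- The cube of generation `j` and index `m` of the dyadic grid. -/
def gridCube (a : Fin n → ℝ) (ℓ : ℝ) (j : ℕ) (m : Fin n → ℕ) : Set (Fin n → ℝ) :=
  cube (fun i => a i + (m i : ℝ) * (ℓ / 2 ^ j)) (ℓ / 2 ^ j)

variable {a : Fin n → ℝ} {ℓ : ℝ}

theorem mem_gridCube (hℓ : 0 < ℓ) {j : ℕ} {m : Fin n → ℕ} {x : Fin n → ℝ} :
    x ∈ gridCube a ℓ j m ↔ ∀ i, gridIndex a ℓ j x i = m i := by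
  rw [gridCube, mem_cube]
  refine forall_congr' fun i => ?_
  have h2 : (0 : ℝ) < 2 ^ j := by positivity
  have key : (x i - a i) / ℓ * ((2 ^ j : ℕ) : ℝ) * (ℓ / 2 ^ j) = x i - a i := by
    push_cast; field_simp
  have hs : 0 < ℓ / 2 ^ j := by positivity
  have h3 := mul_le_mul_iff_left₀ hs (b := ((m i : ℤ) : ℝ)) (c := (x i - a i) / ℓ * (2 ^ j : ℕ))
  have h4 := mul_lt_mul_iff_left₀ hs (b := (x i - a i) / ℓ * (2 ^ j : ℕ)) (c := ((m i : ℤ) : ℝ) + 1)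
  rw [gridIndex, Int.floor_eq_iff, ← h3, ← h4, key, add_mul, one_mul, Int.cast_natCast]
  constructor
  · rintro ⟨h, h'⟩; constructor <;> linarith
  · rintro ⟨h, h'⟩; constructor <;> linarith

/-- Taking floors commutes with division by a positive integer, so a fine index determines every
coarser one. All nesting properties of dyadic cubes come from this. -/
theorem gridIndex_add (a : Fin n → ℝ) (ℓ : ℝ) (j d : ℕ) (x : Fin n → ℝ) (i : Fin n) :
    gridIndex a ℓ j x i = gridIndex a ℓ (j + d) x i / ((2 ^ d : ℕ) : ℤ) := by
  have h := Int.floor_div_natCast ((x i - a i) / ℓ * (2 ^ (j + d) : ℕ)) (2 ^ d)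
  rw [gridIndex, gridIndex, ← h]
  congr 1
  push_cast
  rw [pow_add]
  field_simp

theorem gridCube_subset (hℓ : 0 < ℓ) {j d : ℕ} {m m' : Fin n → ℕ} {x : Fin n → ℝ}
    (hx : x ∈ gridCube a ℓ j m) (hx' : x ∈ gridCube a ℓ (j + d) m') :
    gridCube a ℓ (j + d) m' ⊆ gridCube a ℓ j m := by
  intro y hy
  rw [mem_gridCube hℓ] at *
  intro i
  rw [gridIndex_add a ℓ j d, hy i, ← hx' i, ← gridIndex_add, hx i]

theorem mem_dyadicCubes {Q : Set (Fin n → ℝ)} :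
    Q ∈ dyadicCubes a ℓ ↔ ∃ (j : ℕ) (m : Fin n → ℕ), (∀ i, m i < 2 ^ j) ∧ Q = gridCube a ℓ j m :=
  Iff.rfl

theorem subset_or_subset_of_mem (hℓ : 0 < ℓ) {Q R : Set (Fin n → ℝ)} (hQ : Q ∈ dyadicCubes a ℓ)
    (hR : R ∈ dyadicCubes a ℓ) {x : Fin n → ℝ} (hxQ : x ∈ Q) (hxR : x ∈ R) : Q ⊆ R ∨ R ⊆ Q := by
  obtain ⟨j, m, -, rfl⟩ := mem_dyadicCubes.1 hQ
  obtain ⟨j', m', -, rfl⟩ := mem_dyadicCubes.1 hR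
  rcases le_total j j' with h | h
  · obtain ⟨d, rfl⟩ := Nat.exists_eq_add_of_le h
    exact Or.inr (gridCube_subset hℓ hxQ hxR)
  · obtain ⟨d, rfl⟩ := Nat.exists_eq_add_of_le h
    exact Or.inl (gridCube_subset hℓ hxR hxQ)

theorem gridCube_nonempty (hℓ : 0 < ℓ) (j : ℕ) (m : Fin n → ℕ) : (gridCube a ℓ j m).Nonempty :=
  ⟨_, corner_mem_cube _ (by positivity)⟩

theorem cube_mem_dyadicCubes (a : Fin n → ℝ) (ℓ : ℝ) : cube a ℓ ∈ dyadicCubes a ℓ :=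
  ⟨0, 0, by simp, by simp⟩

theorem exists_cube_of_mem (hℓ : 0 < ℓ) {Q : Set (Fin n → ℝ)} (hQ : Q ∈ dyadicCubes a ℓ) :
    ∃ b s, 0 < s ∧ Q = cube b s := by
  obtain ⟨j, m, -, rfl⟩ := hQ
  exact ⟨_, _, by positivity, rfl⟩

section

variable {Q R : Set (Fin n → ℝ)}

theorem measurableSet_of_mem (hQ : Q ∈ dyadicCubes a ℓ) : MeasurableSet Q := by
  obtain ⟨j, m, -, rfl⟩ := hQ
  exact measurableSet_cube _ _

theorem volume_pos_of_mem (hℓ : 0 < ℓ) (hQ : Q ∈ dyadicCubes a ℓ) : volume Q ≠ 0 := by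
  obtain ⟨b, s, hs, rfl⟩ := exists_cube_of_mem hℓ hQ
  exact volume_cube_pos _ hs

theorem volume_ne_top_of_mem (hQ : Q ∈ dyadicCubes a ℓ) : volume Q ≠ ∞ := by
  obtain ⟨j, m, -, rfl⟩ := hQ
  exact volume_cube_ne_top _ _

theorem nonempty_of_mem (hℓ : 0 < ℓ) (hQ : Q ∈ dyadicCubes a ℓ) : Q.Nonempty := by
  obtain ⟨b, s, hs, rfl⟩ := exists_cube_of_mem hℓ hQ
  exact ⟨_, corner_mem_cube _ hs⟩

theorem subset_cube_of_mem (hℓ : 0 < ℓ) (hQ : Q ∈ dyadicCubes a ℓ) : Q ⊆ cube a ℓ := by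
  obtain ⟨j, m, hm, rfl⟩ := mem_dyadicCubes.1 hQ
  obtain ⟨x, hx⟩ := gridCube_nonempty (a := a) hℓ j m
  have h0 : cube a ℓ = gridCube a ℓ 0 0 := by simp [gridCube]
  rw [h0]
  have hx0 : x ∈ gridCube a ℓ 0 0 := by
    rw [mem_gridCube hℓ] at hx ⊢
    intro i
    -- The bound m i < 2 ^ j enters here: it makes the ancestor index m i / 2 ^ j vanish.
    rw [gridIndex_add a ℓ 0 j, zero_add, hx i]
    have := hm i
    norm_cast
    simpa using Nat.div_eq_of_lt this
  have := gridCube_subset (d := j) (m' := m) hℓ hx0 (by rwa [zero_add])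
  rwa [zero_add] at this

theorem countable_dyadicCubes (a : Fin n → ℝ) (ℓ : ℝ) : (dyadicCubes a ℓ).Countable := by
  refine (Set.countable_range fun z : ℕ × (Fin n → ℕ) => gridCube a ℓ z.1 z.2).mono ?_
  intro Q hQ
  obtain ⟨j, m, -, rfl⟩ := mem_dyadicCubes.1 hQ
  exact ⟨(j, m), rfl⟩

theorem generation_lt_of_ssubset [NeZero n] (hℓ : 0 < ℓ) {j j' : ℕ} {m m' : Fin n → ℕ}
    (h : gridCube a ℓ j' m' ⊂ gridCube a ℓ j m) : j < j' := by
  by_contra! hj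
  obtain ⟨d, rfl⟩ := Nat.exists_eq_add_of_le hj
  obtain ⟨x, hx⟩ := gridCube_nonempty (a := a) hℓ j' m'
  exact h.2 (gridCube_subset hℓ hx (h.1 hx))

/-- Dyadic cubes have a generation, which strictly increases as the cube shrinks. -/
theorem exists_generation [NeZero n] (a : Fin n → ℝ) (hℓ : 0 < ℓ) :
    ∃ gen : Set (Fin n → ℝ) → ℕ, ∀ Q ∈ dyadicCubes a ℓ, ∀ R ∈ dyadicCubes a ℓ,
      R ⊂ Q → gen Q < gen R := by
  classical
  -- Any choice of representation works, since strict inclusion forces a later generation whichever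
  -- indices are chosen.
  refine ⟨fun Q => if h : Q ∈ dyadicCubes a ℓ then h.choose else 0, fun Q hQ R hR hRQ => ?_⟩
  simp only [hQ, hR, dif_pos]
  obtain ⟨m, -, h⟩ := hQ.choose_spec
  obtain ⟨m', -, h'⟩ := hR.choose_spec
  refine generation_lt_of_ssubset (a := a) (m := m) (m' := m') hℓ ?_
  rw [gridCube, gridCube, ← h, ← h']
  exact hRQ

/-- The dyadic parent is obtained by halving the indices. It stays inside Q because the generation
of Q is no later and the two cubes share a point. -/
theorem exists_parent [NeZero n] (hℓ : 0 < ℓ) (hQ : Q ∈ dyadicCubes a ℓ)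
    (hR : R ∈ dyadicCubes a ℓ) (hRQ : R ⊂ Q) :
    ∃ T ∈ dyadicCubes a ℓ, R ⊂ T ∧ T ⊆ Q ∧ volume T = 2 ^ n * volume R := by
  obtain ⟨j, m, hm, rfl⟩ := mem_dyadicCubes.1 hQ
  obtain ⟨j', m', hm', rfl⟩ := mem_dyadicCubes.1 hR
  obtain ⟨x, hx⟩ := gridCube_nonempty (a := a) hℓ j' m'
  have hj := generation_lt_of_ssubset hℓ hRQ
  obtain ⟨d, rfl⟩ := Nat.exists_eq_add_of_lt hj
  have hxT : x ∈ gridCube a ℓ (j + d) (fun i => m' i / 2) := by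
    rw [mem_gridCube hℓ] at hx ⊢
    intro i
    rw [gridIndex_add a ℓ (j + d) 1, hx i]
    norm_cast
  have hv : volume (gridCube a ℓ (j + d) (fun i => m' i / 2))
      = 2 ^ n * volume (gridCube a ℓ (j + d + 1) m') := by
    rw [gridCube, gridCube, volume_cube, volume_cube, ← mul_pow]
    congr 1
    rw [← ENNReal.ofReal_ofNat 2, ← ENNReal.ofReal_mul (by norm_num)]
    congr 1
    rw [pow_succ]
    field_simp
  refine ⟨_, mem_dyadicCubes.2 ⟨j + d, fun i => m' i / 2, fun i => ?_, rfl⟩, ⟨?_, ?_⟩, ?_, hv⟩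
  · have := hm' i
    rw [pow_succ] at this
    exact Nat.div_lt_of_lt_mul (by rwa [mul_comm] at this)
  · exact gridCube_subset hℓ hxT hx
  · intro h
    have h1 := (measure_mono (μ := volume) h)
    rw [hv] at h1
    have h0 := volume_pos_of_mem hℓ hR
    have ht := volume_ne_top_of_mem hR
    -- Strictness is read off from volumes, which needs n ≥ 1.
    have h2 : (1 : ℝ≥0∞) < 2 ^ n := one_lt_pow₀ (by norm_num) (NeZero.ne n)
    have h3 : 1 * volume (gridCube a ℓ (j + d + 1) m')
        < 2 ^ n * volume (gridCube a ℓ (j + d + 1) m') :=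
      ENNReal.mul_lt_mul_left h0 ht h2
    rw [one_mul] at h3
    exact absurd h1 (not_le.2 h3)
  · exact gridCube_subset hℓ (hRQ.1 hx) hxT

/-- A dyadic cube with a given property is contained in a maximal one. -/
theorem exists_maximal_of_mem [NeZero n] (hℓ : 0 < ℓ) {p : Set (Fin n → ℝ) → Prop}
    (hp : ∀ Q, p Q → Q ∈ dyadicCubes a ℓ) (hR : p R) : ∃ Q, R ⊆ Q ∧ Maximal p Q := by
  obtain ⟨gen, hgen⟩ := exists_generation a hℓ
  -- Moving to a strictly larger cube lowers the generation, so the ascent terminates.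
  have key : ∀ N : ℕ, ∀ R, gen R = N → p R → ∃ Q, R ⊆ Q ∧ Maximal p Q := by
    intro N
    induction N using Nat.strong_induction_on with
    | _ N ih =>
      intro R hN hR
      by_cases h : Maximal p R
      · exact ⟨R, subset_rfl, h⟩
      · rw [not_maximal_iff_exists_gt hR] at h
        obtain ⟨T, hRT, hT⟩ := h
        obtain ⟨Q, hTQ, hQ⟩ := ih (gen T) (hN ▸ hgen T (hp T hT) R (hp R hR) hRT) T rfl hT
        exact ⟨Q, (le_of_lt hRT).trans hTQ, hQ⟩
  exact key _ R rfl hR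

/-- Distinct maximal cubes are disjoint. -/
theorem disjoint_of_maximal (hℓ : 0 < ℓ) {p : Set (Fin n → ℝ) → Prop}
    (hp : ∀ Q, p Q → Q ∈ dyadicCubes a ℓ) (hQ : Maximal p Q) (hR : Maximal p R) (hne : Q ≠ R) :
    Disjoint Q R := by
  rw [Set.disjoint_left]
  intro x hxQ hxR
  rcases subset_or_subset_of_mem hℓ (hp _ hQ.prop) (hp _ hR.prop) hxQ hxR with h | h
  · exact hne (hQ.eq_of_le hR.prop h)
  · exact hne (hR.eq_of_le hQ.prop h).symm

end

end SparseBrudnyi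

/-! ### Polynomials of bounded degree on cubes -/

namespace SparseBrudnyi

variable {n : ℕ}

theorem continuous_eval (m : MvPolynomial (Fin n) ℝ) :
    Continuous fun x : Fin n → ℝ => MvPolynomial.eval x m :=
  MvPolynomial.continuous_eval m

theorem exists_abs_eval_le (m : MvPolynomial (Fin n) ℝ) (b : Fin n → ℝ) (s : ℝ) :
    ∃ C : ℝ, ∀ x ∈ cube b s, ‖MvPolynomial.eval x m‖ ≤ C := by
  have hK : IsCompact (Set.univ.pi fun i => Set.Icc (b i) (b i + s)) :=
    isCompact_univ_pi fun _ => isCompact_Icc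
  obtain ⟨C, hC⟩ := hK.exists_bound_of_continuousOn (continuous_eval m).continuousOn
  exact ⟨C, fun x hx => hC x fun i hi => Ico_subset_Icc_self (hx i hi)⟩

instance (b : Fin n → ℝ) (s : ℝ) : IsFiniteMeasure (volume.restrict (cube b s)) :=
  ⟨by simpa using (volume_cube_ne_top b s).lt_top⟩

theorem memLp_eval (m : MvPolynomial (Fin n) ℝ) (b : Fin n → ℝ) (s : ℝ) (q : ℝ≥0∞) :
    MemLp (fun x => MvPolynomial.eval x m) q (volume.restrict (cube b s)) := by
  obtain ⟨C, hC⟩ := exists_abs_eval_le m b s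
  exact MemLp.of_bound (continuous_eval m).aestronglyMeasurable C
    ((ae_restrict_iff' (measurableSet_cube b s)).2 (ae_of_all _ hC))

/-- The class in `L^q(Q)` of a polynomial, `Q` being the cube with corner `b` and side `s`. -/
def evalLp (k : ℕ) (q : ℝ≥0∞) (b : Fin n → ℝ) (s : ℝ) :
    MvPolynomial.restrictTotalDegree (Fin n) ℝ (k - 1) →ₗ[ℝ] Lp ℝ q (volume.restrict (cube b s)) where
  toFun m := (memLp_eval m.1 b s q).toLp
  map_add' m m' := by
    rw [← MemLp.toLp_add]
    congr 1
    ext x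
    simp
  map_smul' c m := by
    rw [RingHom.id_apply, ← MemLp.toLp_const_smul]
    congr 1
    ext x
    simp

/-- By continuity the polynomial vanishes everywhere on the open cube, a product of infinite sets,
hence is zero. -/
theorem eq_zero_of_ae_eval_eq_zero {m : MvPolynomial (Fin n) ℝ} {b : Fin n → ℝ} {s : ℝ} (hs : 0 < s)
    (h : (fun x => MvPolynomial.eval x m) =ᵐ[volume.restrict (cube b s)] 0) : m = 0 := by
  have hsub : (Set.univ.pi fun i => Set.Ioo (b i) (b i + s)) ⊆ cube b s :=
    Set.pi_mono fun i _ => Ioo_subset_Ico_self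
  have hE := Measure.eqOn_open_of_ae_eq (ae_restrict_of_ae_restrict_of_subset hsub h)
    (isOpen_set_pi finite_univ fun _ _ => isOpen_Ioo) (continuous_eval m).continuousOn
    continuousOn_const
  refine MvPolynomial.funext_set (fun i => Set.Ioo (b i) (b i + s))
    (fun i => Set.Ioo_infinite (by linarith)) fun x hx => ?_
  simpa using hE hx

/-- Equivalence of norms in finite dimension: the passage from the L¹ class of a polynomial back to
its continuous values on the closed cube is linear on a finite-dimensional space, hence bounded. -/
theorem exists_enorm_eval_le_unit (n k : ℕ) :
    ∃ C : ℝ≥0, ∀ m ∈ MvPolynomial.restrictTotalDegree (Fin n) ℝ (k - 1), ∀ x ∈ cube 0 1,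
      ‖MvPolynomial.eval x m‖ₑ ≤ C * ∫⁻ y in cube 0 1, ‖MvPolynomial.eval y m‖ₑ := by
  let K : Set (Fin n → ℝ) := Set.univ.pi fun _ => Set.Icc 0 1
  have hK : IsCompact K := isCompact_univ_pi fun _ => isCompact_Icc
  have : CompactSpace K := isCompact_iff_compactSpace.1 hK
  let J := evalLp (n := n) k 1 0 1
  let T : MvPolynomial.restrictTotalDegree (Fin n) ℝ (k - 1) →ₗ[ℝ] C(K, ℝ) :=
    { toFun := fun m => ⟨fun x => MvPolynomial.eval x.1 m.1,
        (continuous_eval m.1).comp continuous_subtype_val⟩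
      map_add' := fun m m' => by ext x; simp
      map_smul' := fun c m => by ext x; simp }
  have hJ : LinearMap.ker J = ⊥ := by
    rw [LinearMap.ker_eq_bot']
    intro m hm
    have h : (memLp_eval m.1 0 1 1).toLp = 0 := hm
    rw [Lp.eq_zero_iff_ae_eq_zero] at h
    exact Subtype.ext (eq_zero_of_ae_eval_eq_zero one_pos ((MemLp.coeFn_toLp _).symm.trans h))
  -- The polynomial is recovered from its L¹ class by g, so T ∘ g restricted to the range of J is
  -- the map to be bounded.
  obtain ⟨g, hg⟩ := J.exists_leftInverse_of_injective hJ
  let L := LinearMap.toContinuousLinearMap ((T ∘ₗ g) ∘ₗ (LinearMap.range J).subtype)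
  refine ⟨‖L‖₊, fun m hm x hx => ?_⟩
  have hxK : x ∈ K := fun i hi => by
    have := hx i hi
    simp only [Pi.zero_apply, zero_add] at this
    exact Ico_subset_Icc_self this
  have h1 : L ⟨J ⟨m, hm⟩, LinearMap.mem_range_self _ _⟩ = T ⟨m, hm⟩ := by
    have : g (J ⟨m, hm⟩) = ⟨m, hm⟩ := LinearMap.congr_fun hg _
    simp [L, this]
  have h2 := L.le_opNorm ⟨J ⟨m, hm⟩, LinearMap.mem_range_self _ _⟩
  rw [h1] at h2
  have h3 : ‖MvPolynomial.eval x m‖ ≤ ‖L‖ * ‖J ⟨m, hm⟩‖ :=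
    ((T ⟨m, hm⟩).norm_coe_le_norm ⟨x, hxK⟩).trans h2
  have h4 : ‖J ⟨m, hm⟩‖ₑ = ∫⁻ y in cube 0 1, ‖MvPolynomial.eval y m‖ₑ := by
    rw [← eLpNorm_one_eq_lintegral_enorm]
    exact Lp.enorm_toLp (memLp_eval m 0 1 1)
  rw [← h4]
  simp only [enorm_eq_nnnorm]
  exact_mod_cast h3

/-- The polynomial `y ↦ m (b + s y)`. -/
def affineComp (b : Fin n → ℝ) (s : ℝ) (m : MvPolynomial (Fin n) ℝ) : MvPolynomial (Fin n) ℝ :=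
  MvPolynomial.bind₁ (fun i => MvPolynomial.C (b i) + MvPolynomial.C s * MvPolynomial.X i) m

theorem eval_affineComp (b : Fin n → ℝ) (s : ℝ) (m : MvPolynomial (Fin n) ℝ) (y : Fin n → ℝ) :
    MvPolynomial.eval y (affineComp b s m) = MvPolynomial.eval (b + s • y) m := by
  have h : (fun i => MvPolynomial.eval y
      (MvPolynomial.C (b i) + MvPolynomial.C s * MvPolynomial.X i)) = b + s • y := by
    ext i
    simp
  rw [affineComp, ← h, MvPolynomial.eval, MvPolynomial.eval₂Hom_bind₁]
  rfl

/-- Each variable is replaced by a polynomial of degree at most one, so no monomial gains degree.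
Rescaling thus stays within the degree bound. -/
theorem totalDegree_affineComp_le (b : Fin n → ℝ) (s : ℝ) (m : MvPolynomial (Fin n) ℝ) :
    (affineComp b s m).totalDegree ≤ m.totalDegree := by
  rw [affineComp, MvPolynomial.bind₁, MvPolynomial.aeval_def, MvPolynomial.eval₂_eq]
  refine MvPolynomial.totalDegree_finsetSum_le fun d hd => ?_
  refine (MvPolynomial.totalDegree_mul _ _).trans ?_
  rw [MvPolynomial.algebraMap_eq, MvPolynomial.totalDegree_C, zero_add]
  refine (MvPolynomial.totalDegree_finsetProd _ _).trans ?_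
  refine le_trans (Finset.sum_le_sum fun i _ => ?_) (MvPolynomial.le_totalDegree hd)
  refine (MvPolynomial.totalDegree_pow _ _).trans ?_
  refine (Nat.mul_le_mul_left _ ?_).trans (mul_one _).le
  refine (MvPolynomial.totalDegree_add _ _).trans (max_le (by simp) ?_)
  refine (MvPolynomial.totalDegree_mul _ _).trans ?_
  rw [MvPolynomial.totalDegree_C, zero_add]
  exact (MvPolynomial.totalDegree_X _).le

theorem lintegral_cube_eq (b : Fin n → ℝ) {s : ℝ} (hs : 0 < s) {F : (Fin n → ℝ) → ℝ≥0∞}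
    (hF : Measurable F) :
    ∫⁻ x in cube b s, F x = ENNReal.ofReal s ^ n * ∫⁻ y in cube 0 1, F (b + s • y) := by
  have hmap : Measure.map (fun y : Fin n → ℝ => b + s • y) volume
      = (ENNReal.ofReal s ^ n)⁻¹ • volume := by
    have : (fun y : Fin n → ℝ => b + s • y) = (fun y => b + y) ∘ (fun y => s • y) := rfl
    rw [this, ← Measure.map_map (by fun_prop) (by fun_prop), Measure.map_addHaar_smul _ hs.ne',
      Measure.map_smul, map_add_left_eq_self]
    congr 1
    rw [abs_of_pos (by positivity), ENNReal.ofReal_inv_of_pos (by positivity),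
      Module.finrank_fin_fun, ENNReal.ofReal_pow hs.le]
  have hpre : (fun y : Fin n → ℝ => b + s • y) ⁻¹' cube b s = cube 0 1 := by
    ext y
    simp only [mem_preimage, mem_cube, Pi.add_apply, Pi.smul_apply, smul_eq_mul, Pi.zero_apply,
      zero_add]
    refine forall_congr' fun i => ?_
    constructor
    · rintro ⟨h1, h2⟩
      exact ⟨by by_contra! h; nlinarith, by by_contra! h; nlinarith⟩
    · rintro ⟨h1, h2⟩
      constructor <;> nlinarith
  have h := setLIntegral_map (μ := volume) (measurableSet_cube b s) hF
    (g := fun y : Fin n → ℝ => b + s • y) (by fun_prop)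
  rw [hpre, hmap, Measure.restrict_smul, lintegral_smul_measure, smul_eq_mul] at h
  rw [← h, ← mul_assoc, ENNReal.mul_inv_cancel, one_mul]
  · exact pow_ne_zero _ (by simpa using hs)
  · exact ENNReal.pow_ne_top ENNReal.ofReal_ne_top

/-- Polynomials of bounded degree on a cube: the supremum is controlled by the `L^q` average,
uniformly in the cube and in `q`. -/
theorem exists_enorm_eval_le (n k : ℕ) :
    ∃ C : ℝ≥0, ∀ (b : Fin n → ℝ) (s : ℝ), 0 < s → ∀ q : ℝ≥0∞, 1 ≤ q →
      ∀ m ∈ MvPolynomial.restrictTotalDegree (Fin n) ℝ (k - 1), ∀ x ∈ cube b s,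
        ‖MvPolynomial.eval x m‖ₑ * volume (cube b s) ^ (1 / q.toReal)
          ≤ C * eLpNorm (fun y => MvPolynomial.eval y m) q (volume.restrict (cube b s)) := by
  obtain ⟨C, hC⟩ := exists_enorm_eval_le_unit n k
  refine ⟨C, fun b s hs q hq m hm x hx => ?_⟩
  have hv0 := volume_cube_pos b hs
  have hvt := volume_cube_ne_top b s
  have h1 : ‖MvPolynomial.eval x m‖ₑ * volume (cube b s)
      ≤ C * ∫⁻ y in cube b s, ‖MvPolynomial.eval y m‖ₑ := by
    have hm' : affineComp b s m ∈ MvPolynomial.restrictTotalDegree (Fin n) ℝ (k - 1) := by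
      rw [MvPolynomial.mem_restrictTotalDegree] at hm ⊢
      exact (totalDegree_affineComp_le b s m).trans hm
    have hx' : s⁻¹ • (x - b) ∈ cube (0 : Fin n → ℝ) 1 := by
      rw [mem_cube] at hx ⊢
      intro i
      have := hx i
      simp only [Pi.smul_apply, Pi.sub_apply, smul_eq_mul, Pi.zero_apply, zero_add]
      rw [inv_mul_eq_div, div_lt_one hs]
      exact ⟨div_nonneg (by linarith) hs.le, by linarith⟩
    have := hC _ hm' _ hx'
    simp only [eval_affineComp] at this
    rw [smul_inv_smul₀ hs.ne', add_sub_cancel] at this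
    rw [lintegral_cube_eq b hs (continuous_eval m).measurable.enorm, volume_cube,
      mul_comm ‖_‖ₑ, mul_left_comm]
    gcongr
  -- Hölder passes from L¹ to L^q at the cost of a power of the volume only, so C does not depend on
  -- q.
  have h2 := eLpNorm_le_eLpNorm_mul_rpow_measure_univ hq
    (μ := volume.restrict (cube b s)) (continuous_eval m).aestronglyMeasurable
  rw [eLpNorm_one_eq_lintegral_enorm, Measure.restrict_apply_univ, ENNReal.toReal_one, div_one] at h2
  have hr0 : volume (cube b s) ^ (1 - 1 / q.toReal) ≠ 0 := by
    simp [ENNReal.rpow_eq_zero_iff, hv0, hvt]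
  have hrt : volume (cube b s) ^ (1 - 1 / q.toReal) ≠ ∞ := by
    simp [ENNReal.rpow_eq_top_iff, hv0, hvt]
  refine (ENNReal.mul_le_mul_iff_left hr0 hrt).1 ?_
  rw [mul_assoc, mul_assoc, ← ENNReal.rpow_add _ _ hv0 hvt, add_sub_cancel,
    ENNReal.rpow_one]
  exact h1.trans (by gcongr)

/-- If the distance E is positive, some competitor falls below 2E. If E = 0, the class of f lies in
the closure of a finite-dimensional, hence closed, subspace. -/
theorem exists_isNearlyBest (k : ℕ) {q : ℝ≥0∞} (hq : 1 ≤ q) {f : (Fin n → ℝ) → ℝ} {b : Fin n → ℝ}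
    {s : ℝ} (hf : MemLp f q (volume.restrict (cube b s))) :
    ∃ P, IsNearlyBest 2 k q f (cube b s) P := by
  have : Fact (1 ≤ q) := ⟨hq⟩
  set E := bestApprox k q f (cube b s) with hE
  have hEt : E ≠ ∞ := by
    refine ne_top_of_le_ne_top hf.2.ne (iInf₂_le_of_le 0 (Submodule.zero_mem _) ?_)
    simp
  have key : ∀ m : MvPolynomial.restrictTotalDegree (Fin n) ℝ (k - 1),
      edist hf.toLp (evalLp k q b s m)
        = eLpNorm (fun x => f x - MvPolynomial.eval x m.1) q (volume.restrict (cube b s)) := by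
    intro m
    rw [evalLp]
    exact Lp.edist_toLp_toLp _ _ hf (memLp_eval m.1 b s q)
  by_cases h0 : E = 0
  · have hcl : hf.toLp ∈ closure (LinearMap.range (evalLp k q b s) : Set _) := by
      rw [EMetric.mem_closure_iff]
      intro ε hε
      have : E < ε := by rwa [h0]
      simp only [hE, bestApprox, iInf_lt_iff] at this
      obtain ⟨m, hm, h⟩ := this
      exact ⟨_, ⟨⟨m, hm⟩, rfl⟩, by rwa [key]⟩
    rw [(Submodule.closed_of_finiteDimensional (LinearMap.range (evalLp k q b s))).closure_eq]
      at hcl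
    obtain ⟨m, hm⟩ := hcl
    refine ⟨m.1, m.2, ?_⟩
    rw [← key, hm, edist_self]
    exact zero_le
  · have : E < 2 * E := by
      rw [two_mul]
      exact ENNReal.lt_add_right hEt h0
    conv_lhs at this => rw [hE, bestApprox]
    simp only [iInf_lt_iff] at this
    obtain ⟨m, hm, h⟩ := this
    exact ⟨m, hm, h.le⟩

end SparseBrudnyi

/-! ### Stopping families and averages -/

namespace SparseBrudnyi

variable {n : ℕ} {a : Fin n → ℝ} {ℓ : ℝ}

/-- The family generated from `Q₀` by passing from a cube `Q` to the maximal cubes `R` with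
`c Q R`. -/
inductive StoppingFamily (c : Set (Fin n → ℝ) → Set (Fin n → ℝ) → Prop) (Q₀ : Set (Fin n → ℝ)) :
    Set (Fin n → ℝ) → Prop
  | base : StoppingFamily c Q₀ Q₀
  | step {Q R : Set (Fin n → ℝ)} :
      StoppingFamily c Q₀ Q → Maximal (c Q) R → StoppingFamily c Q₀ R

section

variable {c : Set (Fin n → ℝ) → Set (Fin n → ℝ) → Prop}

theorem StoppingFamily.mem_dyadicCubes (hc : ∀ Q R, c Q R → R ∈ dyadicCubes a ℓ ∧ R ⊂ Q)
    {Q : Set (Fin n → ℝ)} (hQ : StoppingFamily c (cube a ℓ) Q) : Q ∈ dyadicCubes a ℓ := by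
  cases hQ with
  | base => exact cube_mem_dyadicCubes a ℓ
  | step h hR => exact (hc _ _ hR.prop).1

/-- A descent from Q within the family cannot skip the cubes selected directly below Q. The
induction is on the generation of R, comparing Q with the cube T from which R was selected. -/
theorem StoppingFamily.exists_maximal [NeZero n] (hℓ : 0 < ℓ)
    (hc : ∀ Q R, c Q R → R ∈ dyadicCubes a ℓ ∧ R ⊂ Q) {Q R : Set (Fin n → ℝ)}
    (hQ : StoppingFamily c (cube a ℓ) Q) (hR : StoppingFamily c (cube a ℓ) R) (hRQ : R ⊂ Q) :
    ∃ T, R ⊆ T ∧ Maximal (c Q) T := by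
  obtain ⟨gen, hgen⟩ := exists_generation a hℓ
  have key : ∀ N : ℕ, ∀ R, gen R = N → StoppingFamily c (cube a ℓ) R →
      ∀ Q, StoppingFamily c (cube a ℓ) Q → R ⊂ Q → ∃ T, R ⊆ T ∧ Maximal (c Q) T := by
    intro N
    induction N using Nat.strong_induction_on with
    | _ N ih =>
      intro R hN hR Q hQ hRQ
      have hQD := hQ.mem_dyadicCubes hc
      have hRD := hR.mem_dyadicCubes hc
      cases hR with
      | base => exact absurd (subset_cube_of_mem hℓ hQD) hRQ.2
      | @step T _ hT hRT =>
        have hTD := hT.mem_dyadicCubes hc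
        have hRT' := (hc _ _ hRT.prop).2
        obtain ⟨x, hx⟩ := nonempty_of_mem hℓ hRD
        rcases eq_or_ne T Q with rfl | hne
        · exact ⟨R, subset_rfl, hRT⟩
        rcases subset_or_subset_of_mem hℓ hTD hQD (hRT'.1 hx) (hRQ.1 hx) with h | h
        · obtain ⟨U, hTU, hU⟩ := ih (gen T) (hN ▸ hgen T hTD R hRD hRT') T rfl hT Q hQ
            (h.ssubset_of_ne hne)
          exact ⟨U, hRT'.1.trans hTU, hU⟩
        -- This order is impossible: Q would lie in a cube U selected below T, and maximality of R
        -- gives R = U ⊇ Q.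
        · obtain ⟨U, hQU, hU⟩ := ih (gen Q) (hN ▸ hgen Q hQD R hRD hRQ) Q rfl hQ T hT
            (h.ssubset_of_ne hne.symm)
          have h1 : R ⊆ U := hRQ.1.trans hQU
          have h2 : R = U := hRT.eq_of_le hU.prop h1
          exact absurd (h2 ▸ hQU) hRQ.2
  exact key _ R rfl hR Q hQ hRQ

/-- Reduces sparseness of the family to a volume bound for the maximal cubes of a single stopping
condition. -/
theorem StoppingFamily.maximal_of_mem_children [NeZero n] (hℓ : 0 < ℓ)
    (hc : ∀ Q R, c Q R → R ∈ dyadicCubes a ℓ ∧ R ⊂ Q) {Q R : Set (Fin n → ℝ)}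
    (hQ : StoppingFamily c (cube a ℓ) Q)
    (hR : R ∈ children {Q | StoppingFamily c (cube a ℓ) Q} Q) : Maximal (c Q) R := by
  have hR' : Maximal (fun Q' => StoppingFamily c (cube a ℓ) Q' ∧ Q' ⊂ Q) R := hR
  obtain ⟨T, hRT, hT⟩ := hQ.exists_maximal hℓ hc hR'.prop.1 hR'.prop.2
  have : R = T := hR'.eq_of_le ⟨hQ.step hT, (hc _ _ hT.prop).2⟩ hRT
  rwa [this]

end

/-- The `L^q` average of `g` over `R`. -/
def avgNorm (q : ℝ≥0∞) (g : (Fin n → ℝ) → ℝ) (R : Set (Fin n → ℝ)) : ℝ≥0∞ :=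
  volume R ^ (-(1 / q.toReal)) * eLpNorm g q (volume.restrict R)

/-- The quantity `|Q|^{lam/(nq) - 1/q} E_k(f; Q)_q`. -/
def weightedApprox (k : ℕ) (lam : ℝ) (q : ℝ≥0∞) (f : (Fin n → ℝ) → ℝ) (Q : Set (Fin n → ℝ)) :
    ℝ≥0∞ :=
  volume Q ^ (lam / (n * q.toReal) - 1 / q.toReal) * bestApprox k q f Q

theorem rpow_weight_eq {q : ℝ≥0∞} {lam : ℝ} {R : Set (Fin n → ℝ)}
    (h0 : volume R ≠ 0) (ht : volume R ≠ ∞) :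
    volume R ^ (lam / (n * q.toReal) - 1 / q.toReal)
      = volume R ^ (lam / (n * q.toReal)) * volume R ^ (-(1 / q.toReal)) := by
  rw [← ENNReal.rpow_add _ _ h0 ht, sub_eq_add_neg]

theorem rpow_weight_mul_lintegral {q : ℝ≥0∞} (hq : 1 ≤ q) (hqt : q ≠ ∞) (lam : ℝ)
    (g : (Fin n → ℝ) → ℝ) (R : Set (Fin n → ℝ)) :
    (volume R ^ (lam / n - 1) * ∫⁻ y in R, ‖g y‖ₑ ^ q.toReal) ^ (1 / q.toReal)
      = volume R ^ (lam / (n * q.toReal) - 1 / q.toReal) * eLpNorm g q (volume.restrict R) := by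
  rw [ENNReal.mul_rpow_of_nonneg _ _ (by positivity),
    eLpNorm_eq_lintegral_rpow_enorm_toReal (zero_lt_one.trans_le hq).ne' hqt, ← ENNReal.rpow_mul]
  congr 2
  rw [sub_mul, one_mul, div_mul_div_comm, mul_one]

/-- The stopping condition: `R` is a dyadic subcube of `Q` on which the average of `g` is more than
twice the average on `Q`. -/
def AvgDoubles (a : Fin n → ℝ) (ℓ : ℝ) (q : ℝ≥0∞) (g : (Fin n → ℝ) → ℝ)
    (Q R : Set (Fin n → ℝ)) : Prop :=
  (R ∈ dyadicCubes a ℓ ∧ R ⊂ Q) ∧ 2 * avgNorm q g Q < avgNorm q g R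

/-- Raising the stopping inequality to the power q turns 2 into 2 ^ q ≥ 2. -/
theorem two_mul_volume_mul_le_of_avgDoubles {q : ℝ≥0∞} (hq : 1 ≤ q) (hqt : q ≠ ∞)
    (hℓ : 0 < ℓ) {g : (Fin n → ℝ) → ℝ} {Q R : Set (Fin n → ℝ)} (h : AvgDoubles a ℓ q g Q R) :
    2 * ((volume Q)⁻¹ * ∫⁻ y in Q, ‖g y‖ₑ ^ q.toReal) * volume R
      ≤ ∫⁻ y in R, ‖g y‖ₑ ^ q.toReal := by
  have hq1 : 1 ≤ q.toReal := by
    rw [← ENNReal.toReal_one]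
    exact ENNReal.toReal_mono hqt hq
  have hq0 : 0 < q.toReal := by linarith
  have hpow : ∀ T : Set (Fin n → ℝ), avgNorm q g T ^ q.toReal
      = (volume T)⁻¹ * ∫⁻ y in T, ‖g y‖ₑ ^ q.toReal := by
    intro T
    rw [avgNorm, ENNReal.mul_rpow_of_nonneg _ _ hq0.le, ← ENNReal.rpow_mul,
      eLpNorm_eq_lintegral_rpow_enorm_toReal (zero_lt_one.trans_le hq).ne' hqt, ← ENNReal.rpow_mul,
      neg_mul, one_div_mul_cancel hq0.ne', ENNReal.rpow_one, ENNReal.rpow_neg_one]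
  have h1 := ENNReal.rpow_le_rpow h.2.le hq0.le
  rw [ENNReal.mul_rpow_of_nonneg _ _ hq0.le, hpow, hpow] at h1
  have h2 : (2 : ℝ≥0∞) ≤ 2 ^ q.toReal := by
    conv_lhs => rw [← ENNReal.rpow_one 2]
    exact ENNReal.rpow_le_rpow_of_exponent_le (by norm_num) hq1
  calc _ ≤ 2 ^ q.toReal * ((volume Q)⁻¹ * ∫⁻ y in Q, ‖g y‖ₑ ^ q.toReal) * volume R := by gcongr
    _ ≤ ((volume R)⁻¹ * ∫⁻ y in R, ‖g y‖ₑ ^ q.toReal) * volume R := by gcongr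
    _ = ∫⁻ y in R, ‖g y‖ₑ ^ q.toReal := by
      rw [mul_comm, ← mul_assoc, ENNReal.mul_inv_cancel (volume_pos_of_mem hℓ h.1.1)
        (volume_ne_top_of_mem h.1.1), one_mul]

/-- The selected cubes are disjoint and on each the mean of |g|^q is at least twice its mean over Q.
Summing and cancelling that mean leaves half the volume. -/
theorem tsum_volume_le_half {q : ℝ≥0∞} (hq : 1 ≤ q) (hqt : q ≠ ∞)
    (hℓ : 0 < ℓ) {g : (Fin n → ℝ) → ℝ} {Q : Set (Fin n → ℝ)} (hQ : Q ∈ dyadicCubes a ℓ)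
    (hg : MemLp g q (volume.restrict Q)) {𝓡 : Set (Set (Fin n → ℝ))}
    (h𝓡 : ∀ R ∈ 𝓡, Maximal (AvgDoubles a ℓ q g Q) R) :
    ∑' R : 𝓡, volume (R : Set (Fin n → ℝ)) ≤ volume Q / 2 := by
  have hD : ∀ R, AvgDoubles a ℓ q g Q R → R ∈ dyadicCubes a ℓ := fun R h => h.1.1
  have hcount : Countable 𝓡 :=
    ((countable_dyadicCubes a ℓ).mono fun R hR => hD R (h𝓡 R hR).prop).to_subtype
  set I := ∫⁻ y in Q, ‖g y‖ₑ ^ q.toReal with hI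
  have hIt : I ≠ ∞ :=
    (lintegral_rpow_enorm_lt_top_of_eLpNorm_lt_top (zero_lt_one.trans_le hq).ne' hqt hg.2).ne
  -- A zero mean cannot be cancelled, but then the strict stopping inequality selects nothing.
  by_cases hI0 : I = 0
  · have : IsEmpty 𝓡 := by
      refine ⟨fun ⟨R, hR⟩ => ?_⟩
      have h := (h𝓡 R hR).prop
      have h0 : eLpNorm g q (volume.restrict R) = 0 := by
        refine le_antisymm ?_ zero_le
        refine (eLpNorm_mono_measure _ (Measure.restrict_mono h.1.2.1 le_rfl)).trans ?_
        rw [eLpNorm_eq_lintegral_rpow_enorm_toReal (zero_lt_one.trans_le hq).ne' hqt, ← hI, hI0,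
          ENNReal.zero_rpow_of_pos]
        exact one_div_pos.2 (ENNReal.toReal_pos (zero_lt_one.trans_le hq).ne' hqt)
      have h2 := h.2
      rw [avgNorm, avgNorm, h0, mul_zero] at h2
      exact not_lt_zero h2
    simp
  · have hv0 := volume_pos_of_mem hℓ hQ
    have hvt := volume_ne_top_of_mem hQ
    have h1 : 2 * ((volume Q)⁻¹ * I) * ∑' R : 𝓡, volume (R : Set (Fin n → ℝ)) ≤ I := by
      rw [← ENNReal.tsum_mul_left]
      calc _ ≤ ∑' R : 𝓡, ∫⁻ y in (R : Set (Fin n → ℝ)), ‖g y‖ₑ ^ q.toReal :=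
            ENNReal.tsum_le_tsum fun R =>
              two_mul_volume_mul_le_of_avgDoubles hq hqt hℓ (h𝓡 R R.2).prop
        _ = ∫⁻ y in ⋃ R : 𝓡, (R : Set (Fin n → ℝ)), ‖g y‖ₑ ^ q.toReal := by
            refine (lintegral_iUnion (fun R : 𝓡 => measurableSet_of_mem (hD _ (h𝓡 R R.2).prop))
              (fun R R' hne => ?_) _).symm
            exact disjoint_of_maximal hℓ hD (h𝓡 R R.2) (h𝓡 R' R'.2) fun h => hne (Subtype.ext h)
        _ ≤ I := lintegral_mono_set (iUnion_subset fun R => (h𝓡 R R.2).prop.1.2.1)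
    have h2 : 2 * ((volume Q)⁻¹ * I) * (volume Q / 2) = I := by
      rw [div_eq_mul_inv, show 2 * ((volume Q)⁻¹ * I) * (volume Q * 2⁻¹)
        = (2 * 2⁻¹) * ((volume Q)⁻¹ * volume Q) * I by ring,
        ENNReal.mul_inv_cancel two_ne_zero ENNReal.ofNat_ne_top, ENNReal.inv_mul_cancel hv0 hvt,
        one_mul, one_mul]
    refine (ENNReal.mul_le_mul_iff_right ?_ ?_).1 (h1.trans h2.ge)
    · simp [hI0, hvt]
    · exact ENNReal.mul_ne_top ENNReal.ofNat_ne_top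
        (ENNReal.mul_ne_top (ENNReal.inv_ne_top.2 hv0) hIt)

/-- The average of a polynomial over `R ⊆ Q` is controlled by its average over `Q`. -/
theorem exists_avgNorm_eval_le (n k : ℕ) :
    ∃ C : ℝ≥0, ∀ (a : Fin n → ℝ) (ℓ : ℝ), 0 < ℓ → ∀ q : ℝ≥0∞, 1 ≤ q → q ≠ ∞ →
      ∀ m ∈ MvPolynomial.restrictTotalDegree (Fin n) ℝ (k - 1),
      ∀ Q ∈ dyadicCubes a ℓ, ∀ R ∈ dyadicCubes a ℓ, R ⊆ Q →
        avgNorm q (fun y => MvPolynomial.eval y m) R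
          ≤ C * avgNorm q (fun y => MvPolynomial.eval y m) Q := by
  obtain ⟨C, hC⟩ := exists_enorm_eval_le n k
  refine ⟨C, fun a ℓ hℓ q hq hqt m hm Q hQ R hR hRQ => ?_⟩
  have hQ0 := volume_pos_of_mem hℓ hQ
  have hQt := volume_ne_top_of_mem hQ
  have hR0 := volume_pos_of_mem hℓ hR
  have hRt := volume_ne_top_of_mem hR
  set K := C * avgNorm q (fun y => MvPolynomial.eval y m) Q with hK
  have hsup : ∀ x ∈ R, ‖MvPolynomial.eval x m‖ₑ ≤ ‖K‖ₑ := by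
    intro x hx
    obtain ⟨b, s, hs, rfl⟩ := exists_cube_of_mem hℓ hQ
    have h := hC b s hs q hq m hm x (hRQ hx)
    rw [enorm_eq_self, hK, avgNorm, mul_left_comm, ENNReal.rpow_neg]
    have h0 : volume (cube b s) ^ (1 / q.toReal) ≠ 0 := by
      simp [ENNReal.rpow_eq_zero_iff, hQ0, hQt]
    have ht : volume (cube b s) ^ (1 / q.toReal) ≠ ∞ := by
      simp [ENNReal.rpow_eq_top_iff, hQ0, hQt]
    rw [mul_comm] at h
    calc ‖MvPolynomial.eval x m‖ₑ = (volume (cube b s) ^ (1 / q.toReal))⁻¹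
          * (volume (cube b s) ^ (1 / q.toReal) * ‖MvPolynomial.eval x m‖ₑ) := by
            rw [← mul_assoc, ENNReal.inv_mul_cancel h0 ht, one_mul]
      _ ≤ _ := by gcongr
  have hmono : eLpNorm (fun y => MvPolynomial.eval y m) q (volume.restrict R)
      ≤ eLpNorm (fun _ : Fin n → ℝ => K) q (volume.restrict R) :=
    eLpNorm_mono_enorm_ae
      ((ae_restrict_iff' (measurableSet_of_mem hR)).2 (ae_of_all _ hsup))
  rw [eLpNorm_const' _ (zero_lt_one.trans_le hq).ne' hqt, Measure.restrict_apply_univ,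
    enorm_eq_self] at hmono
  calc avgNorm q (fun y => MvPolynomial.eval y m) R
      ≤ volume R ^ (-(1 / q.toReal)) * (K * volume R ^ (1 / q.toReal)) := by
        rw [avgNorm]; gcongr
    _ = K * (volume R ^ (-(1 / q.toReal)) * volume R ^ (1 / q.toReal)) := by ring
    _ = K := by rw [← ENNReal.rpow_add _ _ hR0 hRt, neg_add_cancel, ENNReal.rpow_zero, mul_one]

/-- The parent of R is Q itself or violates the stopping condition, so its average is at most twice
that of Q. Passing from the parent to R costs 2 ^ (n / q) ≤ 2 ^ n. -/
theorem avgNorm_le_of_maximal [NeZero n] {q : ℝ≥0∞} (hq : 1 ≤ q) (hqt : q ≠ ∞) (hℓ : 0 < ℓ)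
    {g : (Fin n → ℝ) → ℝ} {Q R : Set (Fin n → ℝ)} (hQ : Q ∈ dyadicCubes a ℓ)
    (hR : Maximal (AvgDoubles a ℓ q g Q) R) :
    avgNorm q g R ≤ 2 ^ (n + 1) * avgNorm q g Q := by
  obtain ⟨T, hT, hRT, hTQ, hv⟩ := exists_parent hℓ hQ hR.prop.1.1 hR.prop.1.2
  have hq1 : 1 ≤ q.toReal := by
    rw [← ENNReal.toReal_one]
    exact ENNReal.toReal_mono hqt hq
  have h1 : avgNorm q g T ≤ 2 * avgNorm q g Q := by
    by_contra! h
    rcases eq_or_ne T Q with rfl | hne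
    · refine absurd h (not_lt.2 ?_)
      exact le_mul_of_one_le_left' (by norm_num)
    · exact hRT.2 (hR.2 ⟨⟨hT, hTQ.ssubset_of_ne hne⟩, h⟩ hRT.1)
  have h2 : avgNorm q g R ≤ 2 ^ n * avgNorm q g T := by
    have h3 : volume R ^ (-(1 / q.toReal)) ≤ 2 ^ n * volume T ^ (-(1 / q.toReal)) := by
      have h4 : (2 : ℝ≥0∞) ^ n ≠ 0 := pow_ne_zero _ two_ne_zero
      have h5 : (2 : ℝ≥0∞) ^ n ≠ ∞ := ENNReal.pow_ne_top ENNReal.ofNat_ne_top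
      rw [hv, ENNReal.mul_rpow_of_ne_top h5 (volume_ne_top_of_mem hR.prop.1.1), ← mul_assoc]
      refine le_mul_of_one_le_left' ?_
      conv_lhs => rw [← ENNReal.rpow_zero (x := 2 ^ n)]
      conv_rhs => enter [1]; rw [← ENNReal.rpow_one (2 ^ n)]
      rw [← ENNReal.rpow_add _ _ h4 h5]
      refine ENNReal.rpow_le_rpow_of_exponent_le (one_le_pow₀ (by norm_num)) ?_
      have : 1 / q.toReal ≤ 1 := by
        rw [div_le_one (by linarith)]
        exact hq1
      linarith
    rw [avgNorm, avgNorm, ← mul_assoc]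
    exact mul_le_mul' h3 (eLpNorm_mono_measure _ (Measure.restrict_mono hRT.1 le_rfl))
  calc avgNorm q g R ≤ 2 ^ n * (2 * avgNorm q g Q) := h2.trans (by gcongr)
    _ = 2 ^ (n + 1) * avgNorm q g Q := by ring

theorem avgNorm_add_le {q : ℝ≥0∞} (hq : 1 ≤ q) {g h : (Fin n → ℝ) → ℝ} {R : Set (Fin n → ℝ)}
    (hg : AEStronglyMeasurable g (volume.restrict R))
    (hh : AEStronglyMeasurable h (volume.restrict R)) :
    avgNorm q (fun x => g x + h x) R ≤ avgNorm q g R + avgNorm q h R := by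
  rw [avgNorm, avgNorm, avgNorm, ← mul_add]
  gcongr
  exact eLpNorm_add_le hg hh hq

theorem avgNorm_mono {q : ℝ≥0∞} {g h : (Fin n → ℝ) → ℝ} {R : Set (Fin n → ℝ)}
    (hgh : ∀ x, ‖g x‖ = ‖h x‖) : avgNorm q g R = avgNorm q h R := by
  rw [avgNorm, avgNorm, eLpNorm_congr_norm_ae (ae_of_all _ hgh)]

end SparseBrudnyi

/-! ### Sparse domination of the fractional maximal function -/

namespace SparseBrudnyi

variable {n : ℕ} {a : Fin n → ℝ} {ℓ : ℝ}

theorem bestApprox_le {k : ℕ} {q : ℝ≥0∞} {f : (Fin n → ℝ) → ℝ} {Q : Set (Fin n → ℝ)}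
    {m : MvPolynomial (Fin n) ℝ} (hm : m ∈ MvPolynomial.restrictTotalDegree (Fin n) ℝ (k - 1)) :
    bestApprox k q f Q ≤ eLpNorm (fun x => f x - MvPolynomial.eval x m) q (volume.restrict Q) :=
  iInf₂_le m hm

/-- The residual `f - P_Q` on a stopping cube `R` of `Q`, compared with the residual of `R`. -/
theorem exists_avgNorm_sub_le (n k : ℕ) [NeZero n] (A : ℝ≥0) :
    ∃ C : ℝ≥0, ∀ (a : Fin n → ℝ) (ℓ : ℝ), 0 < ℓ → ∀ q : ℝ≥0∞, 1 ≤ q → q ≠ ∞ →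
      ∀ f : (Fin n → ℝ) → ℝ, MemLp f q (volume.restrict (cube a ℓ)) →
      ∀ P P' : MvPolynomial (Fin n) ℝ, ∀ Q ∈ dyadicCubes a ℓ, ∀ Q' R,
      P ∈ MvPolynomial.restrictTotalDegree (Fin n) ℝ (k - 1) → IsNearlyBest A k q f Q' P' →
      Maximal (AvgDoubles a ℓ q (fun x => f x - MvPolynomial.eval x P) Q) Q' →
      R ∈ dyadicCubes a ℓ → R ⊆ Q' →
      avgNorm q (fun x => f x - MvPolynomial.eval x P) R
        ≤ avgNorm q (fun x => f x - MvPolynomial.eval x P') R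
          + C * avgNorm q (fun x => f x - MvPolynomial.eval x P) Q := by
  obtain ⟨C, hC⟩ := exists_avgNorm_eval_le n k
  -- C transfers the polynomial P' - P from Q' to R, 1 + A adds the two residuals on Q', and 2 ^ (n
  -- + 1) moves from Q' up to Q.
  refine ⟨C * ((1 + A) * 2 ^ (n + 1)), ?_⟩
  intro a ℓ hℓ q hq hqt f hf P P' Q hQ Q' R hP hP' hmax hR hRQ'
  have hQ' := hmax.prop.1.1
  have hmf : ∀ T ∈ dyadicCubes a ℓ, ∀ m : MvPolynomial (Fin n) ℝ,
      AEStronglyMeasurable (fun x => f x - MvPolynomial.eval x m) (volume.restrict T) :=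
    fun T hT m => (hf.1.mono_measure (Measure.restrict_mono (subset_cube_of_mem hℓ hT) le_rfl)).sub
      (continuous_eval m).aestronglyMeasurable
  have hmP : P' - P ∈ MvPolynomial.restrictTotalDegree (Fin n) ℝ (k - 1) :=
    Submodule.sub_mem _ hP'.1 hP
  have h1 : avgNorm q (fun x => f x - MvPolynomial.eval x P) R
      ≤ avgNorm q (fun x => f x - MvPolynomial.eval x P') R
        + avgNorm q (fun x => MvPolynomial.eval x (P' - P)) R := by
    refine le_trans (le_of_eq ?_) (avgNorm_add_le hq (hmf R hR P')
      (continuous_eval _).aestronglyMeasurable)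
    refine avgNorm_mono fun x => ?_
    rw [map_sub, sub_add_sub_cancel]
  have h2 : avgNorm q (fun x => f x - MvPolynomial.eval x P') Q'
      ≤ A * avgNorm q (fun x => f x - MvPolynomial.eval x P) Q' := by
    rw [avgNorm, avgNorm, mul_left_comm]
    gcongr
    exact hP'.2.trans (by gcongr; exact bestApprox_le hP)
  have h3 : avgNorm q (fun x => MvPolynomial.eval x (P' - P)) Q'
      ≤ (1 + A) * avgNorm q (fun x => f x - MvPolynomial.eval x P) Q' := by
    refine le_trans (le_trans (le_of_eq ?_) (avgNorm_add_le hq (hmf Q' hQ' P)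
      (hmf Q' hQ' P').neg)) ?_
    · refine avgNorm_mono fun x => ?_
      rw [Pi.neg_apply, map_sub]
      congr 1
      ring
    · rw [add_mul, one_mul]
      gcongr
      refine le_trans (le_of_eq (avgNorm_mono fun x => ?_)) h2
      rw [Pi.neg_apply, norm_neg]
  calc _ ≤ avgNorm q (fun x => f x - MvPolynomial.eval x P') R
        + avgNorm q (fun x => MvPolynomial.eval x (P' - P)) R := h1
    _ ≤ avgNorm q (fun x => f x - MvPolynomial.eval x P') R
        + C * ((1 + A) * (2 ^ (n + 1) * avgNorm q (fun x => f x - MvPolynomial.eval x P) Q)) := by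
      gcongr
      refine (hC a ℓ hℓ q hq hqt _ hmP Q' hQ' R hR hRQ').trans ?_
      gcongr
      refine h3.trans ?_
      gcongr
      exact avgNorm_le_of_maximal hq hqt hℓ hQ hmax
    _ = _ := by
      push_cast
      ring

/-- One step of the iteration along the stopping family. -/
theorem avgNorm_le_or_exists_maximal [NeZero n] (hℓ : 0 < ℓ) {q : ℝ≥0∞} {g : (Fin n → ℝ) → ℝ}
    {Q R : Set (Fin n → ℝ)} (hR : R ∈ dyadicCubes a ℓ) (hRQ : R ⊆ Q) :
    avgNorm q g R ≤ 2 * avgNorm q g Q ∨ ∃ Q', R ⊆ Q' ∧ Maximal (AvgDoubles a ℓ q g Q) Q' := by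
  by_cases h : AvgDoubles a ℓ q g Q R
  · exact Or.inr (exists_maximal_of_mem hℓ (fun _ h => h.1.1) h)
  · left
    by_contra! hlt
    rcases eq_or_ne R Q with rfl | hne
    · exact absurd hlt (not_lt.2 (le_mul_of_one_le_left' (by norm_num)))
    · exact h ⟨⟨hR, hRQ.ssubset_of_ne hne⟩, hlt⟩

/-- Each passage to a selected cube containing R adds one term for the cube left behind. The process
ends at a cube whose average has not doubled on R. -/
theorem exists_weighted_avgNorm_le_tsum (n k : ℕ) [NeZero n] (A : ℝ≥0) :
    ∃ K : ℝ≥0, ∀ (a : Fin n → ℝ) (ℓ : ℝ), 0 < ℓ → ∀ lam : ℝ, 0 ≤ lam →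
      ∀ q : ℝ≥0∞, 1 ≤ q → q ≠ ∞ →
      ∀ f : (Fin n → ℝ) → ℝ, MemLp f q (volume.restrict (cube a ℓ)) →
      ∀ P : Set (Fin n → ℝ) → MvPolynomial (Fin n) ℝ,
      (∀ Q ∈ dyadicCubes a ℓ, IsNearlyBest A k q f Q (P Q)) →
      ∀ S : Set (Set (Fin n → ℝ)), S ⊆ dyadicCubes a ℓ →
      (∀ Q ∈ S, ∀ R, Maximal (AvgDoubles a ℓ q (fun x => f x - MvPolynomial.eval x (P Q)) Q) R →
        R ∈ S) →
      ∀ Q ∈ S, ∀ R ∈ dyadicCubes a ℓ, R ⊆ Q →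
        volume R ^ (lam / (n * q.toReal))
            * avgNorm q (fun x => f x - MvPolynomial.eval x (P Q)) R
          ≤ K * ∑' T : S, {U : Set (Fin n → ℝ) | R ⊆ U ∧ U ⊆ Q}.indicator
              (weightedApprox k lam q f) T := by
  obtain ⟨C, hC⟩ := exists_avgNorm_sub_le n k A
  -- The 2 comes from the terminal cube, C from each exchange of polynomials, and A from
  -- near-optimality.
  refine ⟨(2 + C) * A, ?_⟩
  intro a ℓ hℓ lam hlam q hq hqt f hf P hP S hSD hS
  have hw0 : 0 ≤ lam / (n * q.toReal) := by positivity
  have hown : ∀ Q ∈ dyadicCubes a ℓ, ∀ R ⊆ Q, volume R ^ (lam / (n * q.toReal))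
      * avgNorm q (fun x => f x - MvPolynomial.eval x (P Q)) Q
        ≤ A * weightedApprox k lam q f Q := by
    intro Q hQ R hRQ
    rw [weightedApprox, rpow_weight_eq (volume_pos_of_mem hℓ hQ) (volume_ne_top_of_mem hQ),
      avgNorm]
    calc _ ≤ volume Q ^ (lam / (n * q.toReal)) * (volume Q ^ (-(1 / q.toReal))
          * (A * bestApprox k q f Q)) := by
          gcongr
          exact (hP Q hQ).2
      _ = _ := by ring
  obtain ⟨gen, hgen⟩ := exists_generation a hℓ
  -- Induction on the gap of generations between Q and R, which shrinks at each selected cube.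
  have key : ∀ N : ℕ, ∀ Q ∈ S, ∀ R ∈ dyadicCubes a ℓ, R ⊆ Q → gen R ≤ gen Q + N →
      volume R ^ (lam / (n * q.toReal)) * avgNorm q (fun x => f x - MvPolynomial.eval x (P Q)) R
        ≤ ((2 + C) * A : ℝ≥0) * ∑' T : S, {U : Set (Fin n → ℝ) | R ⊆ U ∧ U ⊆ Q}.indicator
          (weightedApprox k lam q f) T := by
    intro N
    induction N with
    | zero =>
      intro Q hQ R hR hRQ hN
      have hRQ' : R = Q := by
        by_contra hne
        have := hgen Q (hSD hQ) R hR (hRQ.ssubset_of_ne hne)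
        omega
      subst hRQ'
      refine (hown R (hSD hQ) R subset_rfl).trans ?_
      refine mul_le_mul' ?_ (le_trans ?_ (ENNReal.le_tsum ⟨R, hQ⟩))
      · push_cast
        exact le_mul_of_one_le_left' (le_add_right (by norm_num))
      · simp
    | succ N ih =>
      intro Q hQ R hR hRQ hN
      have hself : {U : Set (Fin n → ℝ) | R ⊆ U ∧ U ⊆ Q}.indicator (weightedApprox k lam q f) Q
          = weightedApprox k lam q f Q := by
        rw [indicator_of_mem]
        exact ⟨hRQ, subset_rfl⟩
      rcases avgNorm_le_or_exists_maximal hℓ hR hRQ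
        (q := q) (g := fun x => f x - MvPolynomial.eval x (P Q)) with h | ⟨Q', hRQ', hmax⟩
      · calc _ ≤ volume R ^ (lam / (n * q.toReal))
              * (2 * avgNorm q (fun x => f x - MvPolynomial.eval x (P Q)) Q) := by gcongr
          _ = 2 * (volume R ^ (lam / (n * q.toReal))
              * avgNorm q (fun x => f x - MvPolynomial.eval x (P Q)) Q) := by ring
          _ ≤ (2 + C) * (A * weightedApprox k lam q f Q) :=
              mul_le_mul' le_self_add (hown Q (hSD hQ) R hRQ)
          _ ≤ _ := by
              push_cast
              rw [← mul_assoc]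
              gcongr
              rw [← hself]
              exact ENNReal.le_tsum (f := fun T : S =>
                {U : Set (Fin n → ℝ) | R ⊆ U ∧ U ⊆ Q}.indicator (weightedApprox k lam q f) T)
                ⟨Q, hQ⟩
      · have hQ'S : Q' ∈ S := hS Q hQ Q' hmax
        have hlt := hgen Q (hSD hQ) Q' (hSD hQ'S) hmax.prop.1.2
        have h1 := ih Q' hQ'S R hR hRQ' (by omega)
        have h2 := hC a ℓ hℓ q hq hqt f hf (P Q) (P Q') Q (hSD hQ) Q' R (hP Q (hSD hQ)).1
          (hP Q' (hSD hQ'S)) hmax hR hRQ'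
        -- Q is not contained in Q', so its term is new and the constant does not grow along the
        -- iteration.
        have hsum : (∑' T : S, {U : Set (Fin n → ℝ) | R ⊆ U ∧ U ⊆ Q'}.indicator
            (weightedApprox k lam q f) T) + weightedApprox k lam q f Q
            ≤ ∑' T : S, {U : Set (Fin n → ℝ) | R ⊆ U ∧ U ⊆ Q}.indicator
              (weightedApprox k lam q f) T := by
          classical
          rw [← tsum_ite_eq (⟨Q, hQ⟩ : S) (fun T : S => weightedApprox k lam q f T),
            ← ENNReal.tsum_add]
          refine ENNReal.tsum_le_tsum fun T => ?_
          by_cases hT : T = ⟨Q, hQ⟩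
          · subst hT
            rw [indicator_of_notMem, if_pos rfl, hself, zero_add]
            exact fun h => hmax.prop.1.2.2 h.2
          · rw [if_neg hT, add_zero]
            refine indicator_le_indicator_of_subset ?_ (fun _ => zero_le) _
            exact fun U hU => ⟨hU.1, hU.2.trans hmax.prop.1.2.1⟩
        calc _ ≤ volume R ^ (lam / (n * q.toReal))
              * (avgNorm q (fun x => f x - MvPolynomial.eval x (P Q')) R
                + C * avgNorm q (fun x => f x - MvPolynomial.eval x (P Q)) Q) := by gcongr
          _ = volume R ^ (lam / (n * q.toReal))
                * avgNorm q (fun x => f x - MvPolynomial.eval x (P Q')) R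
              + C * (volume R ^ (lam / (n * q.toReal))
                * avgNorm q (fun x => f x - MvPolynomial.eval x (P Q)) Q) := by ring
          _ ≤ ((2 + C) * A : ℝ≥0) * (∑' T : S, {U : Set (Fin n → ℝ) | R ⊆ U ∧ U ⊆ Q'}.indicator
                (weightedApprox k lam q f) T)
              + (2 + C) * (A * weightedApprox k lam q f Q) :=
              add_le_add h1 (mul_le_mul' le_add_self (hown Q (hSD hQ) R hRQ))
          _ = ((2 + C) * A : ℝ≥0) * ((∑' T : S, {U : Set (Fin n → ℝ) | R ⊆ U ∧ U ⊆ Q'}.indicator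
                (weightedApprox k lam q f) T) + weightedApprox k lam q f Q) := by
              push_cast
              ring
          _ ≤ _ := by gcongr
  exact fun Q hQ R hR hRQ => key (gen R) Q hQ R hR hRQ (by omega)

/-- Sparse domination of the fractional maximal function. -/
theorem exists_isSparse_fracMaximal_le (n k : ℕ) [NeZero n] (A : ℝ≥0) :
    ∃ K : ℝ≥0, ∀ (a : Fin n → ℝ) (ℓ : ℝ), 0 < ℓ → ∀ lam : ℝ, 0 ≤ lam →
      ∀ q : ℝ≥0∞, 1 ≤ q → q ≠ ∞ →
      ∀ f : (Fin n → ℝ) → ℝ, MemLp f q (volume.restrict (cube a ℓ)) →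
      ∀ P : MvPolynomial (Fin n) ℝ, IsNearlyBest A k q f (cube a ℓ) P →
      ∃ S, IsSparse a ℓ S ∧ ∀ x, fracMaximal a ℓ q lam (fun y => f y - MvPolynomial.eval y P) x
        ≤ K * ∑' Q : S, (Q : Set (Fin n → ℝ)).indicator
          (fun _ => weightedApprox k lam q f Q) x := by
  classical
  -- One constant must serve both the prescribed P on Q₀ (constant A) and the polynomials chosen on
  -- the other cubes (constant 2).
  obtain ⟨K, hK⟩ := exists_weighted_avgNorm_le_tsum n k (A + 2)
  refine ⟨K, ?_⟩
  intro a ℓ hℓ lam hlam q hq hqt f hf P hP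
  have hex : ∀ Q : Set (Fin n → ℝ), ∃ m : MvPolynomial (Fin n) ℝ,
      (Q = cube a ℓ → m = P) ∧ (Q ∈ dyadicCubes a ℓ → IsNearlyBest (A + 2) k q f Q m) := by
    intro Q
    by_cases h : Q = cube a ℓ
    · refine ⟨P, fun _ => rfl, fun _ => ⟨hP.1, ?_⟩⟩
      rw [h]
      refine hP.2.trans ?_
      gcongr
      exact_mod_cast le_self_add
    · by_cases hQ : Q ∈ dyadicCubes a ℓ
      · have hfQ : MemLp f q (volume.restrict Q) :=
          hf.mono_measure (Measure.restrict_mono (subset_cube_of_mem hℓ hQ) le_rfl)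
        obtain ⟨b, s, hs, rfl⟩ := exists_cube_of_mem hℓ hQ
        obtain ⟨m, hm⟩ := exists_isNearlyBest k hq hfQ
        refine ⟨m, fun h' => absurd h' h, fun _ => ⟨hm.1, hm.2.trans ?_⟩⟩
        gcongr
        exact_mod_cast le_add_self
      · exact ⟨0, fun h' => absurd h' h, fun h' => absurd h' hQ⟩
  choose p hp0 hp using hex
  set c := fun Q => AvgDoubles a ℓ q (fun x => f x - MvPolynomial.eval x (p Q)) Q with hc
  have hcD : ∀ Q R, c Q R → R ∈ dyadicCubes a ℓ ∧ R ⊂ Q := fun Q R h => h.1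
  set S : Set (Set (Fin n → ℝ)) := {Q | StoppingFamily c (cube a ℓ) Q} with hS
  have hSD : S ⊆ dyadicCubes a ℓ := fun Q hQ => StoppingFamily.mem_dyadicCubes hcD hQ
  refine ⟨S, ⟨hSD, fun Q hQ => ?_⟩, fun x => ?_⟩
  · refine tsum_volume_le_half hq hqt hℓ (hSD hQ) (g := fun x => f x - MvPolynomial.eval x (p Q)) ?_
      fun R hR => StoppingFamily.maximal_of_mem_children hℓ hcD hQ hR
    refine MemLp.mono_measure (Measure.restrict_mono (subset_cube_of_mem hℓ (hSD hQ)) le_rfl) ?_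
    exact hf.sub (memLp_eval _ _ _ _)
  · rw [fracMaximal]
    refine iSup₂_le fun R hR => iSup_le fun hx => ?_
    rw [rpow_weight_mul_lintegral hq hqt,
      rpow_weight_eq (volume_pos_of_mem hℓ hR) (volume_ne_top_of_mem hR), mul_assoc]
    have h := hK a ℓ hℓ lam hlam q hq hqt f hf p hp S hSD (fun Q hQ R hR => StoppingFamily.step hQ hR)
      (cube a ℓ) StoppingFamily.base R hR (subset_cube_of_mem hℓ hR)
    rw [hp0 _ rfl] at h
    refine h.trans ?_
    gcongr with T
    by_cases hT : (T : Set (Fin n → ℝ)) ∈ {U : Set (Fin n → ℝ) | R ⊆ U ∧ U ⊆ cube a ℓ}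
    · rw [indicator_of_mem hT, indicator_of_mem (hT.1 hx)]
    · rw [indicator_of_notMem hT]
      exact zero_le

end SparseBrudnyi

/-! ### From the cubes of a sparse family to their remainders -/

namespace SparseBrudnyi

variable {n : ℕ} {a : Fin n → ℝ} {ℓ : ℝ} {S : Set (Set (Fin n → ℝ))} {Q R : Set (Fin n → ℝ)}

theorem mem_of_mem_children (hR : R ∈ children S Q) : R ∈ S ∧ R ⊂ Q :=
  Maximal.prop (P := fun Q' => Q' ∈ S ∧ Q' ⊂ Q) hR

theorem remainder_subset : remainder S Q ⊆ Q := sdiff_subset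

theorem countable_children (hS : S ⊆ dyadicCubes a ℓ) : (children S Q).Countable :=
  (countable_dyadicCubes a ℓ).mono fun _ hR => hS (mem_of_mem_children hR).1

theorem measurableSet_remainder (hS : S ⊆ dyadicCubes a ℓ) (hQ : Q ∈ S) :
    MeasurableSet (remainder S Q) :=
  (measurableSet_of_mem (hS hQ)).diff (MeasurableSet.biUnion (countable_children hS)
    fun _ hR => measurableSet_of_mem (hS (mem_of_mem_children hR).1))

/-- Of two intersecting members, the smaller lies in a child of the larger, which the remainder
omits. -/
theorem disjoint_remainder [NeZero n] (hℓ : 0 < ℓ) (hS : S ⊆ dyadicCubes a ℓ) (hQ : Q ∈ S)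
    (hR : R ∈ S) (hne : Q ≠ R) : Disjoint (remainder S Q) (remainder S R) := by
  have key : ∀ {Q R : Set (Fin n → ℝ)}, R ∈ S → R ⊂ Q → ∀ x ∈ R, x ∉ remainder S Q := by
    intro Q R hR hRQ x hx hxQ
    obtain ⟨T, hRT, hT⟩ := exists_maximal_of_mem (a := a) hℓ (p := fun Q' => Q' ∈ S ∧ Q' ⊂ Q)
      (fun _ h => hS h.1) ⟨hR, hRQ⟩
    exact hxQ.2 (mem_biUnion (t := fun R => R) (show T ∈ children S Q from hT) (hRT hx))
  rw [Set.disjoint_left]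
  intro x hxQ hxR
  rcases subset_or_subset_of_mem hℓ (hS hQ) (hS hR) hxQ.1 hxR.1 with h | h
  · exact key hQ (h.ssubset_of_ne hne) x hxQ.1 hxR
  · exact key hR (h.ssubset_of_ne hne.symm) x hxR.1 hxQ

theorem volume_le_two_mul_volume_remainder (hS : IsSparse a ℓ S) (hQ : Q ∈ S) :
    volume Q ≤ 2 * volume (remainder S Q) := by
  have hQt := volume_ne_top_of_mem (hS.1 hQ)
  have h1 : volume (⋃ R ∈ children S Q, R) ≤ volume Q / 2 :=
    (measure_biUnion_le volume (countable_children hS.1) fun R => R).trans (hS.2 Q hQ)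
  have h2 : volume Q ≤ volume Q / 2 + volume (remainder S Q) := by
    have hsub : Q ⊆ (⋃ R ∈ children S Q, R) ∪ remainder S Q := fun x hx =>
      or_iff_not_imp_left.2 fun h => ⟨hx, h⟩
    exact (measure_mono hsub).trans ((measure_union_le _ _).trans (add_le_add h1 le_rfl))
  have h3 : volume Q / 2 ≠ ∞ := ENNReal.div_ne_top hQt two_ne_zero
  have h4 : volume Q / 2 ≤ volume (remainder S Q) := by
    conv_lhs at h2 => rw [← ENNReal.add_halves (volume Q)]
    exact (ENNReal.add_le_add_iff_left h3).1 h2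
  calc volume Q = 2 * (volume Q / 2) := (ENNReal.mul_div_cancel two_ne_zero ENNReal.ofNat_ne_top).symm
    _ ≤ _ := by gcongr

/-- The operator norm is an infimum, so the bound is proved for every admissible C. Dividing by N
first avoids products of 0 and ∞. -/
theorem eLpNorm_dyadicMaximal_le {r : ℝ≥0∞} {g : (Fin n → ℝ) → ℝ}
    (hg : MemLp g r (volume.restrict (cube a ℓ))) {N : ℝ≥0∞} (hN0 : N ≠ 0) (hNt : N ≠ ∞)
    (hN : eLpNorm g r (volume.restrict (cube a ℓ)) ≤ N) :
    eLpNorm (dyadicMaximal a ℓ g) r (volume.restrict (cube a ℓ))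
      ≤ dyadicMaximalOpNorm a ℓ r * N := by
  rw [← ENNReal.div_le_iff hN0 hNt]
  refine le_sInf fun C hC => ?_
  rw [ENNReal.div_le_iff hN0 hNt]
  exact (hC g hg).trans (by gcongr)

theorem measurable_dyadicMaximal (a : Fin n → ℝ) (ℓ : ℝ) (g : (Fin n → ℝ) → ℝ) :
    Measurable (dyadicMaximal a ℓ g) := by
  refine Measurable.biSup _ (countable_dyadicCubes a ℓ) fun Q hQ => ?_
  have : (fun x => ⨆ _ : x ∈ Q, (volume Q)⁻¹ * ∫⁻ y in Q, ‖g y‖ₑ)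
      = Q.indicator fun _ => (volume Q)⁻¹ * ∫⁻ y in Q, ‖g y‖ₑ := by
    ext x
    by_cases hx : x ∈ Q <;> simp [hx]
  rw [this]
  exact measurable_const.indicator (measurableSet_of_mem hQ)

/-- Monotone convergence. The duality argument needs finite sums, whose norms are known to be finite
and can be cancelled. -/
theorem eLpNorm_tsum_le {α ι : Type*} [MeasurableSpace α] [Countable ι] {μ : Measure α} {p : ℝ≥0∞}
    (hp0 : p ≠ 0) (hpt : p ≠ ∞) {u : ι → α → ℝ≥0∞} (hu : ∀ i, Measurable (u i)) {B : ℝ≥0∞}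
    (hB : ∀ T : Finset ι, eLpNorm (fun x => ∑ i ∈ T, u i x) p μ ≤ B) :
    eLpNorm (fun x => ∑' i, u i x) p μ ≤ B := by
  have hp : 0 < p.toReal := ENNReal.toReal_pos hp0 hpt
  have h1 : ∀ x, (∑' i, u i x) ^ p.toReal = ⨆ T : Finset ι, (∑ i ∈ T, u i x) ^ p.toReal := by
    intro x
    rw [ENNReal.tsum_eq_iSup_sum]
    exact (ENNReal.orderIsoRpow p.toReal hp).map_iSup _
  rw [eLpNorm_eq_lintegral_rpow_enorm_toReal hp0 hpt]
  simp only [enorm_eq_self, h1]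
  rw [lintegral_iSup_directed, one_div, ENNReal.rpow_inv_le_iff hp]
  · refine iSup_le fun T => ?_
    have := hB T
    rw [eLpNorm_eq_lintegral_rpow_enorm_toReal hp0 hpt, one_div, ENNReal.rpow_inv_le_iff hp] at this
    simpa only [enorm_eq_self] using this
  · intro T
    exact ((Finset.measurable_sum T fun i _ => hu i).pow_const _).aemeasurable
  · refine Monotone.directed_le fun T T' h x => ?_
    exact ENNReal.rpow_le_rpow (Finset.sum_le_sum_of_subset h) hp.le

theorem toReal_conjExponent {p : ℝ≥0∞} (hp : 1 < p) (hpt : p ≠ ∞) :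
    p.toReal.HolderConjugate (ENNReal.conjExponent p).toReal := by
  lift p to ℝ≥0 using hpt
  have hp' : 1 < p := by exact_mod_cast hp
  rw [← ENNReal.coe_conjExponent hp']
  exact (NNReal.HolderConjugate.conjExponent hp').coe

theorem lintegral_mul_le_eLpNorm_mul_eLpNorm_conjExponent {α : Type*} [MeasurableSpace α]
    {μ : Measure α} {p : ℝ≥0∞} (hp : 1 ≤ p) (hpt : p ≠ ∞) {G H : α → ℝ≥0∞} (hG : AEMeasurable G μ)
    (hH : AEMeasurable H μ) :
    ∫⁻ x, G x * H x ∂μ ≤ eLpNorm G p μ * eLpNorm H (ENNReal.conjExponent p) μ := by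
  rcases hp.eq_or_lt with rfl | hp1
  · have : ENNReal.conjExponent 1 = ∞ := by simp [ENNReal.conjExponent]
    rw [this, eLpNorm_one_eq_lintegral_enorm, eLpNorm_exponent_top, ← lintegral_mul_const'' _ hG.enorm]
    refine lintegral_mono_ae ?_
    filter_upwards [enorm_ae_le_eLpNormEssSup H μ] with x hx
    simp only [enorm_eq_self] at hx ⊢
    gcongr
  · have h := toReal_conjExponent hp1 hpt
    have hc0 : ENNReal.conjExponent p ≠ 0 := fun h0 => by
      have := h.symm.pos
      simp [h0] at this
    have hct : ENNReal.conjExponent p ≠ ∞ := fun h0 => by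
      have := h.symm.pos
      simp [h0] at this
    rw [eLpNorm_eq_lintegral_rpow_enorm_toReal (zero_lt_one.trans_le hp).ne' hpt,
      eLpNorm_eq_lintegral_rpow_enorm_toReal hc0 hct]
    exact ENNReal.lintegral_mul_le_Lp_mul_Lq μ h hG hH

/-- For each Q, the mean of h over Q is a lower bound for the maximal function throughout the
remainder, whose volume is at least |Q| / 2. -/
theorem lintegral_sum_indicator_mul_le (hℓ : 0 < ℓ) (hS : IsSparse a ℓ S)
    (w : Set (Fin n → ℝ) → ℝ≥0∞) {h : (Fin n → ℝ) → ℝ≥0∞} (hh : Measurable h)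
    (hht : ∀ x, h x ≠ ∞) (T : Finset S) :
    ∫⁻ x in cube a ℓ, (∑ Q ∈ T, (Q : Set (Fin n → ℝ)).indicator (fun _ => w Q) x) * h x
      ≤ 2 * ∫⁻ x in cube a ℓ, (∑' Q : S, (remainder S Q).indicator (fun _ => w Q) x)
          * dyadicMaximal a ℓ (fun x => (h x).toReal) x := by
  set M := dyadicMaximal a ℓ (fun x => (h x).toReal) with hM
  have hMm : Measurable M := measurable_dyadicMaximal a ℓ _
  have hone : ∀ Q : S, ∫⁻ x in cube a ℓ, (Q : Set (Fin n → ℝ)).indicator (fun _ => w Q) x * h x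
      ≤ 2 * ∫⁻ x in cube a ℓ, (remainder S Q).indicator (fun _ => w Q) x * M x := by
    rintro ⟨Q, hQ⟩
    have hQD := hS.1 hQ
    have hQs := subset_cube_of_mem hℓ hQD
    have hind : ∀ (E : Set (Fin n → ℝ)) (F : (Fin n → ℝ) → ℝ≥0∞), MeasurableSet E → E ⊆ cube a ℓ →
        Measurable F →
        ∫⁻ x in cube a ℓ, E.indicator (fun _ => w Q) x * F x = w Q * ∫⁻ x in E, F x := by
      intro E F hE hEs hF
      have : ∀ x, E.indicator (fun _ => w Q) x * F x = E.indicator (fun x => w Q * F x) x := by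
        intro x
        by_cases hx : x ∈ E <;> simp [hx]
      simp only [this]
      rw [lintegral_indicator hE, Measure.restrict_restrict hE, inter_eq_self_of_subset_left hEs,
        lintegral_const_mul _ hF]
    have hrem := measurableSet_remainder hS.1 hQ
    rw [hind _ _ (measurableSet_of_mem hQD) hQs hh,
      hind _ _ hrem (remainder_subset.trans hQs) hMm, mul_left_comm]
    gcongr
    have hle : ∀ x ∈ remainder S Q, (volume Q)⁻¹ * ∫⁻ y in Q, h y ≤ M x := by
      intro x hx
      rw [hM, dyadicMaximal]
      refine le_trans (le_of_eq ?_) (le_iSup₂_of_le Q hQD (le_iSup_of_le hx.1 le_rfl))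
      congr 1
      refine lintegral_congr fun y => ?_
      rw [Real.enorm_of_nonneg ENNReal.toReal_nonneg, ENNReal.ofReal_toReal (hht y)]
    calc ∫⁻ x in Q, h x = volume Q * ((volume Q)⁻¹ * ∫⁻ y in Q, h y) := by
          rw [← mul_assoc, ENNReal.mul_inv_cancel (volume_pos_of_mem hℓ hQD)
            (volume_ne_top_of_mem hQD), one_mul]
      _ ≤ 2 * volume (remainder S Q) * ((volume Q)⁻¹ * ∫⁻ y in Q, h y) := by
          gcongr
          exact volume_le_two_mul_volume_remainder hS hQ
      _ = 2 * ∫⁻ x in remainder S Q, (volume Q)⁻¹ * ∫⁻ y in Q, h y := by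
          rw [setLIntegral_const]; ring
      _ ≤ 2 * ∫⁻ x in remainder S Q, M x := by
          gcongr 2 * ?_
          exact setLIntegral_mono hMm hle
  have hms : ∀ Q : S, Measurable fun x => (Q : Set (Fin n → ℝ)).indicator (fun _ => w Q) x * h x :=
    fun Q => (measurable_const.indicator (measurableSet_of_mem (hS.1 Q.2))).mul hh
  have hmr : ∀ Q : S, Measurable fun x => (remainder S Q).indicator (fun _ => w Q) x * M x :=
    fun Q => (measurable_const.indicator (measurableSet_remainder hS.1 Q.2)).mul hMm
  calc _ = ∑ Q ∈ T, ∫⁻ x in cube a ℓ, (Q : Set (Fin n → ℝ)).indicator (fun _ => w Q) x * h x := by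
        simp only [Finset.sum_mul]
        exact lintegral_finsetSum _ fun Q _ => hms Q
    _ ≤ ∑ Q ∈ T, 2 * ∫⁻ x in cube a ℓ, (remainder S Q).indicator (fun _ => w Q) x * M x :=
        Finset.sum_le_sum fun Q _ => hone Q
    _ = 2 * ∫⁻ x in cube a ℓ, (∑ Q ∈ T, (remainder S Q).indicator (fun _ => w Q) x) * M x := by
        simp only [Finset.sum_mul]
        rw [← Finset.mul_sum, lintegral_finsetSum _ fun Q _ => hmr Q]
    _ ≤ _ := by
        gcongr with x
        exact ENNReal.sum_le_tsum T

/-- Passing from the cubes of a sparse family to their remainders in the `L^p` norm. -/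
theorem eLpNorm_tsum_indicator_le [NeZero n] (hℓ : 0 < ℓ) (hS : IsSparse a ℓ S)
    {w : Set (Fin n → ℝ) → ℝ≥0∞} (hw : ∀ Q ∈ S, w Q ≠ ∞) {p : ℝ≥0∞} (hp : 1 ≤ p) (hpt : p ≠ ∞) :
    eLpNorm (fun x => ∑' Q : S, (Q : Set (Fin n → ℝ)).indicator (fun _ => w Q) x) p
        (volume.restrict (cube a ℓ))
      ≤ 2 * dyadicMaximalOpNorm a ℓ (ENNReal.conjExponent p)
        * eLpNorm (fun x => ∑' Q : S, (remainder S Q).indicator (fun _ => w Q) x) p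
          (volume.restrict (cube a ℓ)) := by
  have hSc : Countable S := ((countable_dyadicCubes a ℓ).mono hS.1).to_subtype
  have hp0 : p ≠ 0 := (zero_lt_one.trans_le hp).ne'
  have hp1 : 1 ≤ p.toReal := by
    rw [← ENNReal.toReal_one]
    exact ENNReal.toReal_mono hpt hp
  have hppos : 0 < p.toReal := by linarith
  have hmi : ∀ Q : S, Measurable ((Q : Set (Fin n → ℝ)).indicator fun _ => w Q) :=
    fun Q => measurable_const.indicator (measurableSet_of_mem (hS.1 Q.2))
  have hmr : ∀ Q : S, Measurable ((remainder S Q).indicator fun _ => w Q) :=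
    fun Q => measurable_const.indicator (measurableSet_remainder hS.1 Q.2)
  refine eLpNorm_tsum_le hp0 hpt hmi fun T => ?_
  set F : (Fin n → ℝ) → ℝ≥0∞ :=
    fun x => ∑ Q ∈ T, (Q : Set (Fin n → ℝ)).indicator (fun _ => w Q) x with hF
  set G : (Fin n → ℝ) → ℝ≥0∞ := fun x => ∑' Q : S, (remainder S Q).indicator (fun _ => w Q) x
  have hFm : Measurable F := Finset.measurable_fun_sum T fun Q _ => hmi Q
  have hGm : Measurable G := Measurable.tsum hmr
  have hFB : ∀ x, F x ≤ ∑ Q ∈ T, w Q := fun x =>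
    Finset.sum_le_sum fun Q _ => indicator_le_self' (fun _ _ => zero_le) x
  have hBt : ∑ Q ∈ T, w Q ≠ ∞ := ENNReal.sum_ne_top.2 fun Q _ => hw Q Q.2
  have hFt : ∀ x, F x ≠ ∞ := fun x => ne_top_of_le_ne_top hBt (hFB x)
  set I := ∫⁻ x in cube a ℓ, F x ^ p.toReal with hI
  have hnorm : eLpNorm F p (volume.restrict (cube a ℓ)) = I ^ (1 / p.toReal) := by
    rw [eLpNorm_eq_lintegral_rpow_enorm_toReal hp0 hpt]
    simp only [enorm_eq_self, hI]
  rw [hnorm]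
  have hIt : I ≠ ∞ := by
    refine ne_top_of_le_ne_top ?_ (lintegral_mono fun x =>
      ENNReal.rpow_le_rpow (hFB x) hppos.le)
    rw [setLIntegral_const]
    exact ENNReal.mul_ne_top (ENNReal.rpow_ne_top_of_nonneg hppos.le hBt) (volume_cube_ne_top _ _)
  by_cases hI0 : I = 0
  · rw [hI0, ENNReal.zero_rpow_of_pos (by positivity)]
    exact zero_le
  -- The extremal function for the duality: F h = F ^ p, and its L^{p'} norm is at most I ^ (1 -
  -- 1/p). For p = 1 it is the constant 1.
  set h : (Fin n → ℝ) → ℝ≥0∞ := fun x => F x ^ (p.toReal - 1) with hh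
  have hhm : Measurable h := hFm.pow_const _
  have hht : ∀ x, h x ≠ ∞ := fun x => ENNReal.rpow_ne_top_of_nonneg (by linarith) (hFt x)
  have hIh : I = ∫⁻ x in cube a ℓ, F x * h x := by
    refine lintegral_congr fun x => ?_
    conv_rhs => rw [hh]; enter [1]; rw [← ENNReal.rpow_one (F x)]
    rw [← ENNReal.rpow_add_of_nonneg _ _ zero_le_one (by linarith), add_sub_cancel]
  have hhr : eLpNorm (fun x => (h x).toReal) (ENNReal.conjExponent p) (volume.restrict (cube a ℓ))
      ≤ I ^ (1 - 1 / p.toReal) := by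
    have heq : eLpNorm (fun x => (h x).toReal) (ENNReal.conjExponent p)
        (volume.restrict (cube a ℓ)) = eLpNorm h (ENNReal.conjExponent p)
          (volume.restrict (cube a ℓ)) := by
      refine eLpNorm_congr_enorm_ae (ae_of_all _ fun x => ?_)
      rw [Real.enorm_of_nonneg ENNReal.toReal_nonneg, ENNReal.ofReal_toReal (hht x), enorm_eq_self]
    rw [heq]
    rcases hp.eq_or_lt with rfl | hp1'
    · have : ENNReal.conjExponent 1 = ∞ := by simp [ENNReal.conjExponent]
      rw [this, eLpNorm_exponent_top]
      refine eLpNormEssSup_le_of_ae_enorm_bound (ae_of_all _ fun x => ?_)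
      simp [hh]
    · have hc := toReal_conjExponent hp1' hpt
      have hc0 : ENNReal.conjExponent p ≠ 0 := fun h0 => by
        have := hc.symm.pos
        simp [h0] at this
      have hct : ENNReal.conjExponent p ≠ ∞ := fun h0 => by
        have := hc.symm.pos
        simp [h0] at this
      rw [eLpNorm_eq_lintegral_rpow_enorm_toReal hc0 hct]
      refine le_of_eq ?_
      congr 1
      · refine lintegral_congr fun x => ?_
        rw [enorm_eq_self, hh, ← ENNReal.rpow_mul]
        congr 1
        exact hc.sub_one_mul_conj
      · have := hc.inv_add_inv_eq_one
        rw [one_div, one_div]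
        linarith
  have hN0 : I ^ (1 - 1 / p.toReal) ≠ 0 := by
    simp [ENNReal.rpow_eq_zero_iff, hI0, hIt]
  have hNt : I ^ (1 - 1 / p.toReal) ≠ ∞ := by
    simp [ENNReal.rpow_eq_top_iff, hI0, hIt]
  have hmem : MemLp (fun x => (h x).toReal) (ENNReal.conjExponent p)
      (volume.restrict (cube a ℓ)) :=
    ⟨hhm.ennreal_toReal.aestronglyMeasurable, hhr.trans_lt hNt.lt_top⟩
  have hmain : I ≤ 2 * (eLpNorm G p (volume.restrict (cube a ℓ))
      * (dyadicMaximalOpNorm a ℓ (ENNReal.conjExponent p) * I ^ (1 - 1 / p.toReal))) := by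
    calc I = ∫⁻ x in cube a ℓ, F x * h x := hIh
      _ ≤ 2 * ∫⁻ x in cube a ℓ, G x * dyadicMaximal a ℓ (fun x => (h x).toReal) x :=
          lintegral_sum_indicator_mul_le hℓ hS w hhm hht T
      _ ≤ _ := by
          gcongr 2 * ?_
          refine (lintegral_mul_le_eLpNorm_mul_eLpNorm_conjExponent hp hpt hGm.aemeasurable
            (measurable_dyadicMaximal a ℓ _).aemeasurable).trans ?_
          gcongr
          exact eLpNorm_dyadicMaximal_le hmem hN0 hNt hhr
  refine (ENNReal.mul_le_mul_iff_left hN0 hNt).1 ?_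
  rw [← ENNReal.rpow_add _ _ hI0 hIt, add_sub_cancel, ENNReal.rpow_one]
  exact hmain.trans (le_of_eq (by ring))

end SparseBrudnyi

/-! ### Boundedness of the dyadic maximal operator -/

namespace SparseBrudnyi

variable {n : ℕ} {a : Fin n → ℝ} {ℓ : ℝ}

/-- Weak type estimate for the dyadic maximal function. -/
theorem half_mul_measure_lt_dyadicMaximal_le [NeZero n] (hℓ : 0 < ℓ) (g : (Fin n → ℝ) → ℝ)
    {t : ℝ≥0∞} (ht : t ≠ ∞) :
    t / 2 * volume.restrict (cube a ℓ) {x | t < dyadicMaximal a ℓ g x}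
      ≤ ∫⁻ y in cube a ℓ, {y | t / 2 < ‖g y‖ₑ}.indicator (fun y => ‖g y‖ₑ) y := by
  set φ := {y | t / 2 < ‖g y‖ₑ}.indicator (fun y => ‖g y‖ₑ) with hφ
  have ht2 : t / 2 ≠ ∞ := ENNReal.div_ne_top ht two_ne_zero
  -- The maximal cubes with mean above t are disjoint and cover the level set.
  set c : Set (Fin n → ℝ) → Prop :=
    fun Q => Q ∈ dyadicCubes a ℓ ∧ t * volume Q < ∫⁻ y in Q, ‖g y‖ₑ with hc
  have hcD : ∀ Q, c Q → Q ∈ dyadicCubes a ℓ := fun Q h => h.1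
  set 𝓜 : Set (Set (Fin n → ℝ)) := {Q | Maximal c Q} with h𝓜
  have hMc : ∀ Q : 𝓜, c Q := fun Q => Maximal.prop (P := c) Q.2
  have hcount : Countable 𝓜 :=
    ((countable_dyadicCubes a ℓ).mono fun Q hQ => hcD Q (hMc ⟨Q, hQ⟩)).to_subtype
  have hsub : {x | t < dyadicMaximal a ℓ g x} ⊆ ⋃ Q : 𝓜, (Q : Set (Fin n → ℝ)) := by
    intro x hx
    simp only [mem_ofPred_eq, dyadicMaximal, lt_iSup_iff] at hx
    obtain ⟨Q, hQ, hxQ, h⟩ := hx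
    rw [mul_comm, ← div_eq_mul_inv, ENNReal.lt_div_iff_mul_lt (Or.inl (volume_pos_of_mem hℓ hQ))
      (Or.inl (volume_ne_top_of_mem hQ))] at h
    obtain ⟨T, hQT, hT⟩ := exists_maximal_of_mem hℓ hcD (R := Q) ⟨hQ, h⟩
    exact mem_iUnion.2 ⟨⟨T, hT⟩, hQT hxQ⟩
  have hone : ∀ Q : 𝓜, t / 2 * volume (Q : Set (Fin n → ℝ)) ≤ ∫⁻ y in Q, φ y := by
    intro Q
    have hQ := hMc Q
    -- Values of |g| up to t / 2 account for at most half of the required mass t |Q|, so the large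
    -- values supply the rest.
    have hle : ∀ y, ‖g y‖ₑ ≤ φ y + t / 2 := by
      intro y
      by_cases hy : t / 2 < ‖g y‖ₑ
      · rw [hφ, indicator_of_mem (by exact hy)]
        exact le_self_add
      · rw [hφ, indicator_of_notMem (by exact hy), zero_add]
        exact not_lt.1 hy
    have h1 : t / 2 * volume (Q : Set (Fin n → ℝ)) + t / 2 * volume (Q : Set (Fin n → ℝ))
        ≤ (∫⁻ y in Q, φ y) + t / 2 * volume (Q : Set (Fin n → ℝ)) := by
      rw [← add_mul, ENNReal.add_halves]
      refine hQ.2.le.trans ((lintegral_mono hle).trans ?_)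
      rw [lintegral_add_right _ measurable_const, setLIntegral_const]
    exact (ENNReal.add_le_add_iff_right
      (ENNReal.mul_ne_top ht2 (volume_ne_top_of_mem hQ.1))).1 h1
  calc t / 2 * volume.restrict (cube a ℓ) {x | t < dyadicMaximal a ℓ g x}
      ≤ t / 2 * ∑' Q : 𝓜, volume (Q : Set (Fin n → ℝ)) := by
        gcongr
        exact (Measure.restrict_apply_le _ _).trans ((measure_mono hsub).trans (measure_iUnion_le _))
    _ = ∑' Q : 𝓜, t / 2 * volume (Q : Set (Fin n → ℝ)) := ENNReal.tsum_mul_left.symm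
    _ ≤ ∑' Q : 𝓜, ∫⁻ y in Q, φ y := ENNReal.tsum_le_tsum hone
    _ = ∫⁻ y in ⋃ Q : 𝓜, (Q : Set (Fin n → ℝ)), φ y := by
        refine (lintegral_iUnion (fun Q : 𝓜 => measurableSet_of_mem (hcD _ (hMc Q)))
          (fun Q Q' hne => ?_) _).symm
        exact disjoint_of_maximal hℓ hcD Q.2 Q'.2 fun h => hne (Subtype.ext h)
    _ ≤ ∫⁻ y in cube a ℓ, φ y :=
        lintegral_mono_set (iUnion_subset fun Q => subset_cube_of_mem hℓ (hcD _ (hMc Q)))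

theorem dyadicMaximal_congr_ae (hℓ : 0 < ℓ) {g g' : (Fin n → ℝ) → ℝ}
    (h : g =ᵐ[volume.restrict (cube a ℓ)] g') : dyadicMaximal a ℓ g = dyadicMaximal a ℓ g' := by
  ext x
  refine iSup_congr fun Q => iSup_congr fun hQ => iSup_congr fun _ => ?_
  congr 1
  refine lintegral_congr_ae ?_
  filter_upwards [ae_restrict_of_ae_restrict_of_subset (subset_cube_of_mem hℓ hQ) h] with y hy
  rw [hy]

theorem ae_dyadicMaximal_ne_top [NeZero n] (hℓ : 0 < ℓ) {g : (Fin n → ℝ) → ℝ}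
    (hg : MemLp g 1 (volume.restrict (cube a ℓ))) :
    ∀ᵐ x ∂volume.restrict (cube a ℓ), dyadicMaximal a ℓ g x ≠ ∞ := by
  rw [ae_iff]
  simp only [not_not]
  set m := volume.restrict (cube a ℓ) {x | dyadicMaximal a ℓ g x = ∞} with hm
  set B := ∫⁻ y in cube a ℓ, ‖g y‖ₑ with hB
  have hBt : B ≠ ∞ := by
    have := hg.2.ne
    rwa [eLpNorm_one_eq_lintegral_enorm] at this
  by_contra hm0
  have hmt : m ≠ ∞ := measure_ne_top _ _
  -- At this level the weak type estimate would read B + 1 ≤ B.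
  have ht : 2 * (B + 1) / m ≠ ∞ := ENNReal.div_ne_top
    (ENNReal.mul_ne_top ENNReal.ofNat_ne_top (ENNReal.add_ne_top.2 ⟨hBt, ENNReal.one_ne_top⟩)) hm0
  have h1 : 2 * (B + 1) / m / 2 * m ≤ B := by
    refine le_trans ?_ ((half_mul_measure_lt_dyadicMaximal_le hℓ g ht).trans
      (lintegral_mono fun y => indicator_le_self' (fun _ _ => zero_le) y))
    refine mul_le_mul' le_rfl (measure_mono fun x hx => ?_)
    rw [mem_ofPred_eq] at hx ⊢
    rw [hx]
    exact ht.lt_top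
  have h2 : 2 * (B + 1) / m / 2 * m = B + 1 := by
    rw [div_eq_mul_inv, div_eq_mul_inv, show 2 * (B + 1) * m⁻¹ * 2⁻¹ * m
      = (2 * 2⁻¹) * (m⁻¹ * m) * (B + 1) by ring,
      ENNReal.mul_inv_cancel two_ne_zero ENNReal.ofNat_ne_top, ENNReal.inv_mul_cancel hm0 hmt,
      one_mul, one_mul]
  rw [h2] at h1
  exact absurd h1 (not_le.2 (ENNReal.lt_add_right hBt one_ne_zero))

/-- Marcinkiewicz interpolation by hand: layer cake for the maximal function, the truncated weak
type estimate at each height, then layer cake backwards for 2|g| with exponent r - 1 against the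
measure with density |g|. The constant is the product of the factors from these steps. -/
theorem lintegral_dyadicMaximal_rpow_le [NeZero n] (hℓ : 0 < ℓ) {r : ℝ} (hr : 1 < r)
    {g : (Fin n → ℝ) → ℝ} (hgm : Measurable g) (hg : MemLp g 1 (volume.restrict (cube a ℓ))) :
    ∫⁻ x in cube a ℓ, dyadicMaximal a ℓ g x ^ r
      ≤ ENNReal.ofReal (r * 2 * (r - 1)⁻¹ * 2 ^ (r - 1)) * ∫⁻ x in cube a ℓ, ‖g x‖ₑ ^ r := by
  have hr0 : 0 < r := by linarith
  have hr1 : 0 < r - 1 := by linarith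
  set μ := volume.restrict (cube a ℓ) with hμ
  set ν := μ.withDensity fun y => ‖g y‖ₑ with hν
  have hMm := measurable_dyadicMaximal a ℓ g
  have h1 : ∫⁻ x, dyadicMaximal a ℓ g x ^ r ∂μ
      = ∫⁻ x, ENNReal.ofReal ((dyadicMaximal a ℓ g x).toReal ^ r) ∂μ := by
    refine lintegral_congr_ae ?_
    filter_upwards [ae_dyadicMaximal_ne_top hℓ hg] with x hx
    rw [← ENNReal.ofReal_rpow_of_nonneg ENNReal.toReal_nonneg hr0.le, ENNReal.ofReal_toReal hx]
  rw [h1, lintegral_rpow_eq_lintegral_meas_lt_mul μ (ae_of_all _ fun _ => ENNReal.toReal_nonneg)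
    hMm.ennreal_toReal.aemeasurable hr0]
  have h2 : ∀ t ∈ Ioi (0 : ℝ), μ {x | t < (dyadicMaximal a ℓ g x).toReal}
      * ENNReal.ofReal (t ^ (r - 1))
      ≤ 2 * (ν {x | t < 2 * ‖g x‖} * ENNReal.ofReal (t ^ (r - 1 - 1))) := by
    intro t ht
    have ht0 : 0 < t := ht
    have h3 : ENNReal.ofReal t * μ {x | t < (dyadicMaximal a ℓ g x).toReal}
        ≤ 2 * ν {x | t < 2 * ‖g x‖} := by
      have h4 := half_mul_measure_lt_dyadicMaximal_le (a := a) hℓ g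
        (ENNReal.ofReal_ne_top (r := t))
      have hset : {y | ENNReal.ofReal t / 2 < ‖g y‖ₑ} = {x | t < 2 * ‖g x‖} := by
        ext x
        rw [mem_ofPred_eq, mem_ofPred_eq, ← ofReal_norm,
          ENNReal.div_lt_iff (Or.inl two_ne_zero) (Or.inl ENNReal.ofNat_ne_top),
          ← ENNReal.ofReal_ofNat 2, ← ENNReal.ofReal_mul (norm_nonneg _),
          ENNReal.ofReal_lt_ofReal_iff_of_nonneg ht0.le, mul_comm]
      have hms : MeasurableSet {x | t < 2 * ‖g x‖} :=
        measurableSet_lt measurable_const (hgm.norm.const_mul 2)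
      rw [hset, lintegral_indicator hms, ← withDensity_apply _ hms] at h4
      calc ENNReal.ofReal t * μ {x | t < (dyadicMaximal a ℓ g x).toReal}
          = 2 * (ENNReal.ofReal t / 2 * μ {x | t < (dyadicMaximal a ℓ g x).toReal}) := by
            rw [← mul_assoc, ENNReal.mul_div_cancel two_ne_zero ENNReal.ofNat_ne_top]
        _ ≤ 2 * (ENNReal.ofReal t / 2 * μ {x | ENNReal.ofReal t < dyadicMaximal a ℓ g x}) := by
            gcongr with x
            intro hx
            refine (ENNReal.ofReal_lt_iff_lt_toReal ht0.le fun htop => ?_).2 hx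
            rw [htop, ENNReal.toReal_top] at hx
            exact lt_asymm ht0 hx
        _ ≤ _ := by gcongr
    have h5 : ENNReal.ofReal (t ^ (r - 1))
        = ENNReal.ofReal t * ENNReal.ofReal (t ^ (r - 1 - 1)) := by
      rw [← ENNReal.ofReal_mul ht0.le]
      congr 1
      conv_rhs => enter [1]; rw [← Real.rpow_one t]
      rw [← Real.rpow_add ht0, add_sub_cancel]
    rw [h5]
    calc _ = ENNReal.ofReal t * μ {x | t < (dyadicMaximal a ℓ g x).toReal}
          * ENNReal.ofReal (t ^ (r - 1 - 1)) := by ring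
      _ ≤ 2 * ν {x | t < 2 * ‖g x‖} * ENNReal.ofReal (t ^ (r - 1 - 1)) := by gcongr
      _ = _ := by ring
  have h6 := lintegral_rpow_eq_lintegral_meas_lt_mul ν (f := fun x => 2 * ‖g x‖)
    (ae_of_all _ fun _ => by positivity) (hgm.norm.const_mul 2).aemeasurable hr1
  have h7 : ∫⁻ x, ENNReal.ofReal ((2 * ‖g x‖) ^ (r - 1)) ∂ν
      = ENNReal.ofReal (2 ^ (r - 1)) * ∫⁻ x, ‖g x‖ₑ ^ r ∂μ := by
    rw [lintegral_withDensity_eq_lintegral_mul _ hgm.enorm (by fun_prop),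
      ← lintegral_const_mul _ (by fun_prop)]
    refine lintegral_congr fun x => ?_
    rw [Pi.mul_apply, Real.mul_rpow zero_le_two (norm_nonneg _), ENNReal.ofReal_mul (by positivity),
      ← ENNReal.ofReal_rpow_of_nonneg (norm_nonneg _) hr1.le, ofReal_norm, mul_left_comm]
    congr 1
    conv_lhs => enter [1]; rw [← ENNReal.rpow_one ‖g x‖ₑ]
    rw [← ENNReal.rpow_add_of_nonneg _ _ zero_le_one hr1.le, add_sub_cancel]
  set J := ∫⁻ t in Ioi (0 : ℝ), ν {x | t < 2 * ‖g x‖} * ENNReal.ofReal (t ^ (r - 1 - 1)) with hJ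
  have h8 : J = ENNReal.ofReal (r - 1)⁻¹ * (ENNReal.ofReal (2 ^ (r - 1))
      * ∫⁻ x, ‖g x‖ₑ ^ r ∂μ) := by
    rw [← h7, h6, ← mul_assoc, ← ENNReal.ofReal_mul (by positivity), inv_mul_cancel₀ hr1.ne',
      ENNReal.ofReal_one, one_mul]
  calc _ ≤ ENNReal.ofReal r * (2 * J) := by
        gcongr
        rw [hJ, ← lintegral_const_mul' _ _ ENNReal.ofNat_ne_top]
        exact setLIntegral_mono' measurableSet_Ioi h2
    _ = _ := by
        rw [h8, ← ENNReal.ofReal_ofNat 2, ← mul_assoc, ← mul_assoc, ← mul_assoc,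
          ← ENNReal.ofReal_mul hr0.le, ← ENNReal.ofReal_mul (by positivity),
          ← ENNReal.ofReal_mul (by positivity)]

theorem dyadicMaximal_le_eLpNorm_top (hℓ : 0 < ℓ) (g : (Fin n → ℝ) → ℝ) (x : Fin n → ℝ) :
    dyadicMaximal a ℓ g x ≤ eLpNorm g ∞ (volume.restrict (cube a ℓ)) := by
  refine iSup₂_le fun Q hQ => iSup_le fun _ => ?_
  have h : ∫⁻ y in Q, ‖g y‖ₑ ≤ eLpNorm g ∞ (volume.restrict (cube a ℓ)) * volume Q := by
    rw [← setLIntegral_const]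
    refine lintegral_mono_ae ?_
    exact ae_restrict_of_ae_restrict_of_subset (subset_cube_of_mem hℓ hQ)
      (by rw [eLpNorm_exponent_top]; exact enorm_ae_le_eLpNormEssSup g _)
  calc _ ≤ (volume Q)⁻¹ * (eLpNorm g ∞ (volume.restrict (cube a ℓ)) * volume Q) := by gcongr
    _ = _ := by
      rw [mul_left_comm, ENNReal.inv_mul_cancel (volume_pos_of_mem hℓ hQ) (volume_ne_top_of_mem hQ),
        mul_one]

theorem eLpNorm_dyadicMaximal_le_rpow_mul [NeZero n] (hℓ : 0 < ℓ) {r : ℝ≥0∞} (hr : 1 < r)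
    (hrt : r ≠ ∞) {g : (Fin n → ℝ) → ℝ} (hg : MemLp g r (volume.restrict (cube a ℓ))) :
    eLpNorm (dyadicMaximal a ℓ g) r (volume.restrict (cube a ℓ))
      ≤ ENNReal.ofReal (r.toReal * 2 * (r.toReal - 1)⁻¹ * 2 ^ (r.toReal - 1)) ^ (1 / r.toReal)
        * eLpNorm g r (volume.restrict (cube a ℓ)) := by
  have hr0 : r ≠ 0 := (zero_lt_one.trans hr).ne'
  have hr1 : 1 < r.toReal := by
    rw [← ENNReal.toReal_one]
    exact (ENNReal.toReal_lt_toReal ENNReal.one_ne_top hrt).2 hr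
  obtain ⟨g', hgm', hae⟩ := hg.1
  have hg' := (memLp_congr_ae hae).1 hg
  rw [dyadicMaximal_congr_ae hℓ hae, eLpNorm_congr_ae hae,
    eLpNorm_eq_lintegral_rpow_enorm_toReal hr0 hrt, eLpNorm_eq_lintegral_rpow_enorm_toReal hr0 hrt,
    ← ENNReal.mul_rpow_of_nonneg _ _ (by positivity)]
  refine ENNReal.rpow_le_rpow ?_ (by positivity)
  simp only [enorm_eq_self]
  exact lintegral_dyadicMaximal_rpow_le hℓ hr1 hgm'.measurable
    (hg'.mono_exponent hr.le)

/-- Only finiteness matters here: it serves the equality of the spaces, while the norm inequality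
keeps the operator norm explicit. -/
theorem dyadicMaximalOpNorm_ne_top [NeZero n] (hℓ : 0 < ℓ) {r : ℝ≥0∞} (hr : 1 < r) :
    dyadicMaximalOpNorm a ℓ r ≠ ∞ := by
  by_cases hrt : r = ∞
  · subst hrt
    refine ne_top_of_le_ne_top ENNReal.one_ne_top (sInf_le fun g _ => ?_)
    rw [one_mul, eLpNorm_exponent_top]
    exact eLpNormEssSup_le_of_ae_enorm_bound
      (ae_of_all _ fun x => dyadicMaximal_le_eLpNorm_top hℓ g x)
  · refine ne_top_of_le_ne_top ?_ (sInf_le fun g hg => eLpNorm_dyadicMaximal_le_rpow_mul hℓ hr hrt hg)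
    exact ENNReal.rpow_ne_top_of_nonneg (by positivity) ENNReal.ofReal_ne_top

end SparseBrudnyi

/-! ### Comparison of the two functionals -/

namespace SparseBrudnyi

variable {n : ℕ} {a : Fin n → ℝ} {ℓ : ℝ}

theorem measurable_fracMaximal (a : Fin n → ℝ) (ℓ : ℝ) (q : ℝ≥0∞) (lam : ℝ)
    (f : (Fin n → ℝ) → ℝ) : Measurable (fracMaximal a ℓ q lam f) := by
  refine Measurable.biSup _ (countable_dyadicCubes a ℓ) fun Q hQ => ?_
  set c := (volume Q ^ (lam / n - 1) * ∫⁻ y in Q, ‖f y‖ₑ ^ q.toReal) ^ (1 / q.toReal)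
  have : (fun x => ⨆ _ : x ∈ Q, c) = Q.indicator fun _ => c := by
    ext x
    by_cases hx : x ∈ Q <;> simp [hx]
  rw [this]
  exact measurable_const.indicator (measurableSet_of_mem hQ)

/-- The functional of the sparse Brudnyi space is dominated by the fractional maximal function of
the residual of any polynomial. -/
theorem svNorm_le_eLpNorm_fracMaximal [NeZero n] (hℓ : 0 < ℓ) {k : ℕ} {lam : ℝ} {p q : ℝ≥0∞}
    (hq : 1 ≤ q) (hqt : q ≠ ∞) {f : (Fin n → ℝ) → ℝ} {P : MvPolynomial (Fin n) ℝ}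
    (hP : P ∈ MvPolynomial.restrictTotalDegree (Fin n) ℝ (k - 1)) :
    svNorm a ℓ k lam p q f
      ≤ eLpNorm (fracMaximal a ℓ q lam fun x => f x - MvPolynomial.eval x P) p
        (volume.restrict (cube a ℓ)) := by
  refine iSup₂_le fun S hS => eLpNorm_mono_enorm fun x => ?_
  rw [enorm_eq_self, enorm_eq_self]
  -- By disjointness of the remainders, at most one term of the sum survives at x.
  by_cases h : ∃ Q : S, x ∈ remainder S Q
  · obtain ⟨Q, hxQ⟩ := h
    rw [tsum_eq_single Q, indicator_of_mem hxQ]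
    · refine le_trans ?_ (le_iSup₂_of_le (Q : Set (Fin n → ℝ)) (hS.1 Q.2)
        (le_iSup_of_le hxQ.1 le_rfl))
      rw [rpow_weight_mul_lintegral hq hqt]
      gcongr
      exact bestApprox_le hP
    · intro R hne
      refine indicator_of_notMem (fun hxR => ?_) _
      exact Set.disjoint_left.1 (disjoint_remainder hℓ hS.1 R.2 Q.2 fun h => hne (Subtype.ext h))
        hxR hxQ
  · push Not at h
    rw [ENNReal.tsum_eq_zero.2 fun Q => indicator_of_notMem (h Q) _]
    exact zero_le

theorem weightedApprox_ne_top (hℓ : 0 < ℓ) {k : ℕ} {lam : ℝ} {q : ℝ≥0∞} {f : (Fin n → ℝ) → ℝ}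
    (hf : MemLp f q (volume.restrict (cube a ℓ))) {Q : Set (Fin n → ℝ)}
    (hQ : Q ∈ dyadicCubes a ℓ) : weightedApprox k lam q f Q ≠ ∞ := by
  refine ENNReal.mul_ne_top ?_ ?_
  · simp [ENNReal.rpow_eq_top_iff, volume_pos_of_mem hℓ hQ, volume_ne_top_of_mem hQ]
  · have h : MemLp f q (volume.restrict Q) :=
      hf.mono_measure (Measure.restrict_mono (subset_cube_of_mem hℓ hQ) le_rfl)
    refine ne_top_of_le_ne_top h.2.ne ((bestApprox_le (Submodule.zero_mem _)).trans ?_)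
    simp

theorem exists_eLpNorm_fracMaximal_le (n k : ℕ) [NeZero n] (A : ℝ≥0) :
    ∃ K : ℝ≥0, ∀ (a : Fin n → ℝ) (ℓ : ℝ), 0 < ℓ → ∀ lam : ℝ, 0 ≤ lam →
      ∀ p q : ℝ≥0∞, 1 ≤ p → p ≠ ∞ → 1 ≤ q → q ≠ ∞ →
      ∀ f : (Fin n → ℝ) → ℝ, MemLp f q (volume.restrict (cube a ℓ)) →
      ∀ P : MvPolynomial (Fin n) ℝ, IsNearlyBest A k q f (cube a ℓ) P →
      eLpNorm (fracMaximal a ℓ q lam fun x => f x - MvPolynomial.eval x P) p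
          (volume.restrict (cube a ℓ))
        ≤ K * dyadicMaximalOpNorm a ℓ (ENNReal.conjExponent p) * svNorm a ℓ k lam p q f := by
  obtain ⟨K, hK⟩ := exists_isSparse_fracMaximal_le n k A
  refine ⟨K * 2, ?_⟩
  intro a ℓ hℓ lam hlam p q hp hpt hq hqt f hf P hP
  obtain ⟨S, hS, hSle⟩ := hK a ℓ hℓ lam hlam q hq hqt f hf P hP
  have h1 : eLpNorm (fracMaximal a ℓ q lam fun x => f x - MvPolynomial.eval x P) p
      (volume.restrict (cube a ℓ)) ≤ K * eLpNorm (fun x => ∑' Q : S,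
        (Q : Set (Fin n → ℝ)).indicator (fun _ => weightedApprox k lam q f Q) x) p
          (volume.restrict (cube a ℓ)) := by
    refine eLpNorm_le_nnreal_smul_eLpNorm_of_ae_le_mul' (ae_of_all _ fun x => ?_) p
    exact hSle x
  have h2 := eLpNorm_tsum_indicator_le hℓ hS
    (fun Q hQ => weightedApprox_ne_top (k := k) (lam := lam) hℓ hf (hS.1 hQ)) hp hpt
  have h3 : eLpNorm (fun x => ∑' Q : S, (remainder S (Q : Set (Fin n → ℝ))).indicator
      (fun _ => weightedApprox k lam q f Q) x) p (volume.restrict (cube a ℓ))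
      ≤ svNorm a ℓ k lam p q f := le_iSup₂_of_le S hS le_rfl
  calc _ ≤ K * (2 * dyadicMaximalOpNorm a ℓ (ENNReal.conjExponent p) * svNorm a ℓ k lam p q f) :=
        h1.trans (by gcongr; exact h2.trans (by gcongr))
    _ = _ := by
        push_cast
        ring

/-- The fractional maximal functions of `f` and of `f - P` differ by at most a constant. -/
theorem exists_fracMaximal_le_add (hℓ : 0 < ℓ) {k : ℕ} {lam : ℝ} (hlam : 0 ≤ lam) {q : ℝ≥0∞}
    (hq : 1 ≤ q) (hqt : q ≠ ∞) {f : (Fin n → ℝ) → ℝ}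
    (hf : MemLp f q (volume.restrict (cube a ℓ))) {P : MvPolynomial (Fin n) ℝ}
    (hP : P ∈ MvPolynomial.restrictTotalDegree (Fin n) ℝ (k - 1)) :
    ∃ C : ℝ≥0∞, C ≠ ∞ ∧ ∀ x, fracMaximal a ℓ q lam f x
      ≤ fracMaximal a ℓ q lam (fun y => f y - MvPolynomial.eval y P) x + C := by
  obtain ⟨C, hC⟩ := exists_avgNorm_eval_le n k
  have hQ0 := cube_mem_dyadicCubes a ℓ
  have hw0 : 0 ≤ lam / (n * q.toReal) := by positivity
  -- Both the weight (as lam ≥ 0) and, up to C, the average of P are largest on the whole cube.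
  refine ⟨volume (cube a ℓ) ^ (lam / (n * q.toReal))
    * (C * avgNorm q (fun y => MvPolynomial.eval y P) (cube a ℓ)), ?_, fun x => ?_⟩
  · refine ENNReal.mul_ne_top (ENNReal.rpow_ne_top_of_nonneg hw0 (volume_cube_ne_top _ _))
      (ENNReal.mul_ne_top ENNReal.coe_ne_top (ENNReal.mul_ne_top ?_ (memLp_eval P a ℓ q).2.ne))
    simp [ENNReal.rpow_eq_top_iff, volume_cube_pos a hℓ, volume_cube_ne_top a ℓ]
  · refine iSup₂_le fun R hR => iSup_le fun hx => ?_
    have hRs := subset_cube_of_mem hℓ hR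
    have hM : volume R ^ (lam / (n * q.toReal))
        * avgNorm q (fun y => f y - MvPolynomial.eval y P) R
        ≤ fracMaximal a ℓ q lam (fun y => f y - MvPolynomial.eval y P) x := by
      refine le_trans (le_of_eq ?_) (le_iSup₂_of_le R hR (le_iSup_of_le hx le_rfl))
      rw [rpow_weight_mul_lintegral hq hqt,
        rpow_weight_eq (volume_pos_of_mem hℓ hR) (volume_ne_top_of_mem hR), mul_assoc, avgNorm]
    rw [rpow_weight_mul_lintegral hq hqt,
      rpow_weight_eq (volume_pos_of_mem hℓ hR) (volume_ne_top_of_mem hR), mul_assoc]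
    change volume R ^ (lam / (n * q.toReal)) * avgNorm q f R ≤ _
    have hadd : avgNorm q f R ≤ avgNorm q (fun y => f y - MvPolynomial.eval y P) R
        + avgNorm q (fun y => MvPolynomial.eval y P) R := by
      refine le_trans (le_of_eq ?_) (avgNorm_add_le hq ?_ (continuous_eval P).aestronglyMeasurable)
      · exact avgNorm_mono fun y => by rw [sub_add_cancel]
      · exact (hf.1.mono_measure (Measure.restrict_mono hRs le_rfl)).sub
          (continuous_eval P).aestronglyMeasurable
    calc _ ≤ volume R ^ (lam / (n * q.toReal))
          * (avgNorm q (fun y => f y - MvPolynomial.eval y P) R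
            + avgNorm q (fun y => MvPolynomial.eval y P) R) := by gcongr
      _ ≤ _ := by
        rw [mul_add]
        gcongr
        exact hC a ℓ hℓ q hq hqt P hP _ hQ0 R hR hRs

theorem svSpace_eq_fracMaximalLp [NeZero n] (hℓ : 0 < ℓ) (k : ℕ) {lam : ℝ} (hlam : 0 ≤ lam)
    {p q : ℝ≥0∞} (hp : 1 ≤ p) (hpt : p ≠ ∞) (hq : 1 ≤ q) (hqt : q ≠ ∞) :
    svSpace a ℓ k lam p q = fracMaximalLp a ℓ q lam p := by
  ext f
  refine and_congr_right fun hf => ⟨fun h => ?_, fun h => ?_⟩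
  · obtain ⟨P, hP⟩ := exists_isNearlyBest k hq hf
    obtain ⟨K, hK⟩ := exists_eLpNorm_fracMaximal_le n k 2
    have h1 := hK a ℓ hℓ lam hlam p q hp hpt hq hqt f hf P hP
    have hop : dyadicMaximalOpNorm a ℓ (ENNReal.conjExponent p) ≠ ∞ := by
      -- The conjugate exponent is 1 + (p - 1)⁻¹, which exceeds 1 because p is finite.
      refine dyadicMaximalOpNorm_ne_top hℓ ?_
      refine ENNReal.lt_add_right ENNReal.one_ne_top ?_
      exact ENNReal.inv_ne_zero.2 (ENNReal.sub_ne_top hpt)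
    obtain ⟨C, hCt, hC⟩ := exists_fracMaximal_le_add (lam := lam) hℓ hlam hq hqt hf hP.1
    refine lt_of_le_of_lt (eLpNorm_mono_enorm (g := fun x => fracMaximal a ℓ q lam
      (fun y => f y - MvPolynomial.eval y P) x + C) fun x => by simpa using hC x) ?_
    refine lt_of_le_of_lt (eLpNorm_add_le (measurable_fracMaximal _ _ _ _ _).aestronglyMeasurable
      aestronglyMeasurable_const hp) ?_
    refine ENNReal.add_lt_top.2 ⟨h1.trans_lt ?_, ?_⟩
    · exact (ENNReal.mul_ne_top (ENNReal.mul_ne_top ENNReal.coe_ne_top hop) h.ne).lt_top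
    · rw [eLpNorm_const' _ (zero_lt_one.trans_le hp).ne' hpt, enorm_eq_self]
      refine (ENNReal.mul_ne_top hCt (ENNReal.rpow_ne_top_of_nonneg (by positivity) ?_)).lt_top
      exact measure_ne_top _ _
  -- The lower comparison holds for any polynomial, not only a nearly best one. With 0 the residual
  -- is f itself.
  · have h0 : (0 : MvPolynomial (Fin n) ℝ) ∈ MvPolynomial.restrictTotalDegree (Fin n) ℝ (k - 1) :=
      Submodule.zero_mem _
    refine (svNorm_le_eLpNorm_fracMaximal hℓ hq hqt h0).trans_lt ?_
    simpa using h

end SparseBrudnyi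

end

theorem mainTheorem1 (n k : ℕ) (hk : 1 ≤ k) (A : ℝ≥0) (hA : 1 ≤ A) :
    ∃ c : ℝ≥0, ∀ (a : Fin n → ℝ) (ℓ : ℝ) (_ : 0 < ℓ) (lam : ℝ) (_ : 0 ≤ lam) (_ : lam < n)
      (p q : ℝ≥0∞) (_ : 1 ≤ p) (_ : p ≠ ∞) (_ : 1 ≤ q) (_ : q ≠ ∞),
      SparseBrudnyi.svSpace a ℓ k lam p q = SparseBrudnyi.fracMaximalLp a ℓ q lam p ∧
      ∀ (f : (Fin n → ℝ) → ℝ) (_ : MemLp f q (volume.restrict (SparseBrudnyi.cube a ℓ)))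
        (P : MvPolynomial (Fin n) ℝ)
        (_ : SparseBrudnyi.IsNearlyBest A k q f (SparseBrudnyi.cube a ℓ) P),
        eLpNorm (SparseBrudnyi.fracMaximal a ℓ q lam (fun x => f x - MvPolynomial.eval x P)) p
            (volume.restrict (SparseBrudnyi.cube a ℓ))
          ≤ c * SparseBrudnyi.dyadicMaximalOpNorm a ℓ (ENNReal.conjExponent p)
              * SparseBrudnyi.svNorm a ℓ k lam p q f ∧
        SparseBrudnyi.svNorm a ℓ k lam p q f
          ≤ 2 * eLpNorm
              (SparseBrudnyi.fracMaximal a ℓ q lam (fun x => f x - MvPolynomial.eval x P)) p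
              (volume.restrict (SparseBrudnyi.cube a ℓ)) := by
  rcases Nat.eq_zero_or_pos n with rfl | hn
  -- In dimension 0 no lam satisfies 0 ≤ lam < n.
  · refine ⟨0, fun a ℓ _ lam h0 h1 => ?_⟩
    rw [Nat.cast_zero] at h1
    exact absurd h0 (not_le.2 h1)
  have : NeZero n := ⟨hn.ne'⟩
  obtain ⟨c, hc⟩ := SparseBrudnyi.exists_eLpNorm_fracMaximal_le n k A
  refine ⟨c, fun a ℓ hℓ lam hlam _ p q hp hpt hq hqt =>
    ⟨SparseBrudnyi.svSpace_eq_fracMaximalLp hℓ k hlam hp hpt hq hqt, fun f hf P hP =>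
      ⟨hc a ℓ hℓ lam hlam p q hp hpt hq hqt f hf P hP, ?_⟩⟩⟩
  exact (SparseBrudnyi.svNorm_le_eLpNorm_fracMaximal hℓ hq hqt hP.1).trans
    (le_mul_of_one_le_left' (by norm_num))
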